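/- Let $E$ be a Hausdorff, sequentially complete, barreled locally convex space over $\mathbb{C}$, let $L(E)$ be the space of continuous linear operators on $E$ (with the topology of uniform convergence on bounded sets), let $C\in L(E)$ (not necessarily injective), and let $\alpha\ge 0$. Put $g_\beta(t)=t^{\beta-1}/\Gamma(\beta)$ and write $\mathcal{D}=C_c^\infty(\mathbb{R})$, $\mathcal{D}_0=\{\varphi\in\mathcal{D}:\operatorname{supp}\varphi\subseteq[0,\infty)\}$. Let $(S_\alpha(t))_{t\ge 0}\subseteq L(E)$ be an $\alpha$-times integrated $C$-semigroup: it is strongly continuous, $S_\alpha(t)C=CS_\alpha(t)$ for $t\ge0$, and for all $t,s\ge 0$, $x\in E$, $$S_\alpha(t)S_\alpha(s)x=\Bigl[\int_0^{t+s}-\int_0^t-\int_0^s\Bigr]g_\alpha(t+s-r)S_\alpha(r)Cx\,dr\quad(\alpha>0),\qquad S_0(t)S_0(s)x=S_0(t+s)Cx\quad(\alpha=0).$$ Assume that it is exponentially equicontinuous, i.e. for some $\omega\in\mathbb{R}$ the family $\{e^{-\omega t}S_\alpha(t):t\ge 0\}$ is equicontinuous, and let $\mathcal{A}$ be its integral generator,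 the multivalued linear operator with graph $$\mathcal{A}=\Bigl\{(x,y)\in E\times E:\ S_\alpha(t)x-g_{\alpha+1}(t)Cx=\int_0^tS_\alpha(s)y\,ds\ \text{ for all } t\ge 0\Bigr\}.$$ For $\varphi\in\mathcal{D}$ let $W^\alpha_+\varphi$ be the Weyl fractional derivative: with $n=\lceil\alpha\rceil$, $W^\alpha_+\varphi=(-1)^n\varphi^{(n)}$ if $\alpha=n$, and otherwise $$W^\alpha_+\varphi(t)=\frac{(-1)^n}{\Gamma(n-\alpha)}\frac{d^n}{dt^n}\int_t^\infty(s-t)^{n-\alpha-1}\varphi(s)\,ds .$$ Then the formula $$\mathcal{G}(\varphi)x=\int_0^\infty W^\alpha_+\varphi(t)\,S_\alpha(t)x\,dt,\qquad \varphi\in\mathcal{D},\ x\in E,$$ defines an $L(E)$-valued distribution $\mathcal{G}$ (a continuous linear map $\mathcal{D}\to L(E)$) which is an exponential pre-$(C\text{-DS})$, that is: 1. $\mathcal{G}$ is supported in $[0,\infty)$, $C\mathcal{G}(\varphi)=\mathcal{G}(\varphi)C$ for all $\varphi\in\mathcal{D}$, and $\mathcal{G}(\varphi*_0\psi)C=\mathcal{G}(\varphi)\mathcal{G}(\psi)$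 for all $\varphi,\psi\in\mathcal{D}$, where $(\varphi*_0\psi)(t)=\int_0^t\varphi(t-s)\psi(s)\,ds$; 2. there is $\omega\in\mathbb{R}$ such that the distribution $e^{-\omega t}\mathcal{G}:\varphi\mapsto\mathcal{G}(e^{-\omega\cdot}\varphi)$ is tempered, i.e. extends to a continuous linear map $\mathcal{S}(\mathbb{R})\to L(E)$. Moreover, the integral generator of $\mathcal{G}$, i.e. the multivalued linear operator with graph $$\bigl\{(x,y)\in E\times E:\ \mathcal{G}(-\varphi')x=\mathcal{G}(\varphi)y\ \text{ for all }\varphi\in\mathcal{D}_0\bigr\},$$ contains $\mathcal{A}$. -/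

import Mathlib

open Set Filter Topology MeasureTheory TopologicalSpace
open scoped Distributions SchwartzMap ContDiff LineDeriv

noncomputable section

namespace CDS

/-! ### Test functions on the line -/

/-- The space `𝓓 = C_c^∞(ℝ)` of complex test functions, with its usual locally convex topology. -/
abbrev TestFn : Type := 𝓓((⊤ : Opens ℝ), ℂ)

theorem contDiff_integral_nat (n : ℕ) :
    ∀ g : ℝ × ℝ → ℂ, ContDiff ℝ ∞ g →
      ContDiff ℝ n (fun t : ℝ => ∫ u in (0 : ℝ)..1, g (t, u)) := by
  have key : ∀ g : ℝ × ℝ → ℂ, ContDiff ℝ ∞ g → ∀ t₀ : ℝ,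
      HasDerivAt (fun t : ℝ => ∫ u in (0 : ℝ)..1, g (t, u))
        (∫ u in (0 : ℝ)..1, fderiv ℝ g (t₀, u) (1, 0)) t₀ := by
    intro g hg t₀
    have hg' : Continuous fun p : ℝ × ℝ => fderiv ℝ g p (1, 0) :=
      (hg.continuous_fderiv (by simp)).clm_apply continuous_const
    obtain ⟨K, hK⟩ := ((isCompact_Icc (a := t₀ - 1) (b := t₀ + 1)).prod
      (isCompact_Icc (a := (0 : ℝ)) (b := 1))).exists_bound_of_continuousOn hg'.continuousOn
    have hgc := hg.continuous
    refine (intervalIntegral.hasDerivAt_integral_of_dominated_loc_of_deriv_le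
      (F := fun t u => g (t, u)) (F' := fun t u => fderiv ℝ g (t, u) (1, 0))
      (s := Icc (t₀ - 1) (t₀ + 1)) (bound := fun _ => K)
      (Icc_mem_nhds (by linarith) (by linarith)) ?_ ?_ ?_ ?_ ?_ ?_).2
    · exact Eventually.of_forall fun t => (by fun_prop : Continuous fun u => g (t, u)).aestronglyMeasurable
    · exact (by fun_prop : Continuous fun u => g (t₀, u)).intervalIntegrable _ _
    · exact (hg'.comp (by fun_prop : Continuous fun u : ℝ => (t₀, u))).aestronglyMeasurable
    · refine Eventually.of_forall fun u hu t ht => hK (t, u) ⟨ht, ?_⟩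
      rw [uIoc_of_le zero_le_one] at hu
      exact ⟨hu.1.le, hu.2⟩
    · exact intervalIntegrable_const
    · refine Eventually.of_forall fun u _ t _ => ?_
      have h1 : HasFDerivAt g (fderiv ℝ g (t, u)) (t, u) :=
        (hg.differentiable (by simp) (t, u)).hasFDerivAt
      exact h1.comp_hasDerivAt t ((hasDerivAt_id t).prodMk (hasDerivAt_const t u))
  induction n with
  | zero =>
    intro g hg
    exact contDiff_zero.2 (continuous_iff_continuousAt.2 fun t => (key g hg t).continuousAt)
  | succ n ih =>
    intro g hg
    rw [Nat.cast_add, Nat.cast_one, contDiff_succ_iff_deriv]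
    refine ⟨fun t => (key g hg t).differentiableAt, by simp, ?_⟩
    rw [funext fun t => (key g hg t).deriv]
    exact ih (fun p => fderiv ℝ g p (1, 0))
      ((hg.fderiv_right (m := ∞) (by simp)).clm_apply contDiff_const)

theorem contDiff_convZero (φ ψ : ℝ → ℂ) (hφ : ContDiff ℝ ∞ φ) (hψ : ContDiff ℝ ∞ ψ) :
    ContDiff ℝ ∞ (fun t : ℝ => ∫ s in (0 : ℝ)..t, φ (t - s) * ψ s) := by
  have h : (fun t : ℝ => ∫ s in (0 : ℝ)..t, φ (t - s) * ψ s) =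
      fun t : ℝ => (t : ℂ) * ∫ u in (0 : ℝ)..1, φ (t - t * u) * ψ (t * u) := by
    funext t
    have := intervalIntegral.smul_integral_comp_mul_left
      (a := 0) (b := 1) (fun s => φ (t - s) * ψ s) t
    simp only [mul_zero, mul_one] at this
    rw [← this, Complex.real_smul]
  rw [h]
  refine Complex.ofRealCLM.contDiff.mul (contDiff_infty.2 fun n => ?_)
  exact contDiff_integral_nat n (fun p => φ (p.1 - p.1 * p.2) * ψ (p.1 * p.2))
    ((hφ.comp (contDiff_fst.sub (contDiff_fst.mul contDiff_snd))).mul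
      (hψ.comp (contDiff_fst.mul contDiff_snd)))

theorem hasCompactSupport_convZero (φ ψ : ℝ → ℂ) (hφ : HasCompactSupport φ)
    (hψ : HasCompactSupport ψ) :
    HasCompactSupport (fun t : ℝ => ∫ s in (0 : ℝ)..t, φ (t - s) * ψ s) := by
  obtain ⟨M, hM⟩ := hφ.isBounded.exists_norm_le
  obtain ⟨N, hN⟩ := hψ.isBounded.exists_norm_le
  refine HasCompactSupport.intro (isCompact_Icc (a := -(M + N)) (b := M + N)) fun t ht => ?_
  refine intervalIntegral.integral_zero_ae (Eventually.of_forall fun s _ => ?_)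
  by_contra h
  have h1 := hM _ (subset_tsupport φ (left_ne_zero_of_mul h))
  have h2 := hN _ (subset_tsupport ψ (right_ne_zero_of_mul h))
  rw [Real.norm_eq_abs, abs_le] at h1 h2
  exact ht ⟨by linarith, by linarith⟩

/-- The convolution product `(φ *₀ ψ)(t) = ∫_0^t φ(t - s) ψ(s) ds`, `t ∈ ℝ`. -/
def convZero (φ ψ : TestFn) : TestFn where
  toFun t := ∫ s in (0 : ℝ)..t, φ (t - s) * ψ s
  contDiff' := contDiff_convZero φ ψ φ.contDiff ψ.contDiff
  hasCompactSupport' := hasCompactSupport_convZero φ ψ φ.hasCompactSupport ψ.hasCompactSupport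
  tsupport_subset' := fun _ _ => trivial

/-- The test function `t ↦ e^{-wt} φ(t)`. -/
def expMul (w : ℝ) (φ : TestFn) : TestFn where
  toFun t := ((Real.exp (-w * t) : ℝ) : ℂ) * φ t
  contDiff' := ContDiff.mul (Complex.ofRealCLM.contDiff.comp
    (Real.contDiff_exp.comp (contDiff_const.mul contDiff_id))) φ.contDiff
  hasCompactSupport' := φ.hasCompactSupport.mul_left
  tsupport_subset' := fun _ _ => trivial

/-- A test function as an element of the Schwartz space. -/
def toSchwartz (φ : TestFn) : 𝓢(ℝ, ℂ) :=
  φ.hasCompactSupport.toSchwartzMap φ.contDiff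

/-- The Weyl fractional derivative `W^α_+ f` of order `α ≥ 0`: with `n = ⌈α⌉`, it is
`(-1)^n f^{(n)}` if `α = n`, and otherwise
`(-1)^n / Γ(n - α) · d^n/dt^n ∫_t^∞ (s - t)^{n - α - 1} f(s) ds`. -/
def weylDeriv (α : ℝ) (f : ℝ → ℂ) (t : ℝ) : ℂ :=
  if α = (⌈α⌉₊ : ℝ) then (-1) ^ ⌈α⌉₊ * iteratedDeriv ⌈α⌉₊ f t
  else (-1) ^ ⌈α⌉₊ / ((Real.Gamma ((⌈α⌉₊ : ℝ) - α) : ℝ) : ℂ) *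
    iteratedDeriv ⌈α⌉₊
      (fun r : ℝ => ∫ s in Ioi r, (((s - r) ^ ((⌈α⌉₊ : ℝ) - α - 1) : ℝ) : ℂ) * f s) t

/-- `g_α(t) = t^{α-1} / Γ(α)`. -/
def gKer (α t : ℝ) : ℝ := t ^ (α - 1) / Real.Gamma α

/-! ### Vector-valued integration -/

section Integral

variable {E : Type*} [AddCommGroup E] [Module ℂ E] [TopologicalSpace E]

/-- `y = ∫ u dμ` for a function `u` with values in a locally convex space: `u` is scalarly
integrable, and `f(y) = ∫ f(u) dμ` for every continuous linear functional `f`. In a Hausdorff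
locally convex space there is at most one such `y`. -/
def HasIntegral (u : ℝ → E) (μ : Measure ℝ) (y : E) : Prop :=
  ∀ f : E →L[ℂ] ℂ, Integrable (fun t => f (u t)) μ ∧ ∫ t, f (u t) ∂μ = f y

theorem HasIntegral.zero (μ : Measure ℝ) : HasIntegral (fun _ => (0 : E)) μ 0 := by
  intro f
  simp

theorem HasIntegral.add {u v : ℝ → E} {μ : Measure ℝ} {y z : E} (hu : HasIntegral u μ y)
    (hv : HasIntegral v μ z) : HasIntegral (fun t => u t + v t) μ (y + z) := by
  intro f
  simp only [map_add]
  exact ⟨(hu f).1.add (hv f).1, by rw [integral_add (hu f).1 (hv f).1, (hu f).2, (hv f).2]⟩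

theorem HasIntegral.smul {u : ℝ → E} {μ : Measure ℝ} {y : E} (c : ℂ) (hu : HasIntegral u μ y) :
    HasIntegral (fun t => c • u t) μ (c • y) := by
  intro f
  simp only [map_smul]
  exact ⟨(hu f).1.smul c, by rw [integral_smul, (hu f).2]⟩

end Integral

/-! ### Fractionally integrated `C`-semigroups

A family `(S(t))_{t ≥ 0}` of operators is given as a function on `ℝ`, of which only the values at
`t ≥ 0` are ever used. Multivalued linear operators in `E` are identified with their graphs, the
linear subspaces of `E × E`; inclusion of operators is inclusion of graphs. -/

section Semigroup

variable {E : Type*} [AddCommGroup E] [Module ℂ E]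

/-- `(S(t))_{t ≥ 0}` is a global `α`-times integrated `C`-semigroup (`C` need not be injective);
for `α = 0` this is a global `C`-regularized semigroup. -/
structure IsIntegratedSemigroup [TopologicalSpace E] (α : ℝ) (C : E →L[ℂ] E)
    (S : ℝ → E →L[ℂ] E) : Prop where
  /-- strong continuity on `[0, ∞)` -/
  continuousOn : ∀ x : E, ContinuousOn (fun t => S t x) (Ici 0)
  /-- `S(t) C = C S(t)` -/
  comm : ∀ t : ℝ, 0 ≤ t → ∀ x : E, S t (C x) = C (S t x)
  /-- for `α = 0`: `S(t) S(s) = S(t + s) C` -/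
  law_zero : α = 0 → ∀ t s : ℝ, 0 ≤ t → 0 ≤ s → ∀ x : E, S t (S s x) = S (t + s) (C x)
  /-- for `α > 0`: `S(t) S(s) x = [∫_0^{t+s} - ∫_0^t - ∫_0^s] g_α(t + s - r) S(r) C x dr` -/
  law_pos : 0 < α → ∀ t s : ℝ, 0 ≤ t → 0 ≤ s → ∀ x : E, ∃ y₁ y₂ y₃ : E,
    HasIntegral (fun r => ((gKer α (t + s - r) : ℝ) : ℂ) • S r (C x))
      (volume.restrict (Ioc 0 (t + s))) y₁ ∧
    HasIntegral (fun r => ((gKer α (t + s - r) : ℝ) : ℂ) • S r (C x))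
      (volume.restrict (Ioc 0 t)) y₂ ∧
    HasIntegral (fun r => ((gKer α (t + s - r) : ℝ) : ℂ) • S r (C x))
      (volume.restrict (Ioc 0 s)) y₃ ∧
    S t (S s x) = y₁ - y₂ - y₃

/-- There is `w ∈ ℝ` such that the family `{e^{-wt} S(t) : t ≥ 0}` is equicontinuous. -/
def IsExpEquicontinuous [UniformSpace E] (S : ℝ → E →L[ℂ] E) : Prop :=
  ∃ w : ℝ, Equicontinuous
    (fun (t : Ici (0 : ℝ)) (x : E) => ((Real.exp (-w * (t : ℝ)) : ℝ) : ℂ) • S t x)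

/-- The integral generator of `(S(t))_{t ≥ 0}`: all pairs `(x, y)` such that
`S(t) x - g_{α+1}(t) C x = ∫_0^t S(s) y ds` for all `t ≥ 0`. -/
def integralGenerator [TopologicalSpace E] (α : ℝ) (C : E →L[ℂ] E)
    (S : ℝ → E →L[ℂ] E) : Submodule ℂ (E × E) where
  carrier := {p | ∀ t : ℝ, 0 ≤ t → HasIntegral (fun s => S s p.2) (volume.restrict (Ioc 0 t))
    (S t p.1 - ((gKer (α + 1) t : ℝ) : ℂ) • C p.1)}
  zero_mem' := by
    intro t _
    simpa using HasIntegral.zero (E := E) (volume.restrict (Ioc 0 t))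
  add_mem' := by
    intro p q hp hq t ht
    have h := (hp t ht).add (hq t ht)
    simp only [Prod.fst_add, Prod.snd_add, map_add, smul_add]
    rwa [add_sub_add_comm]
  smul_mem' := by
    intro c p hp t ht
    have h := (hp t ht).smul c
    simp only [Prod.smul_fst, Prod.smul_snd, map_smul]
    rwa [smul_sub, smul_comm c] at h

end Semigroup

/-! ### Degenerate `C`-distribution semigroups -/

section Distribution

variable {E : Type*} [AddCommGroup E] [Module ℂ E] [TopologicalSpace E]
  [IsTopologicalAddGroup E] [ContinuousSMul ℂ E]

/-- `G` is a pre-(C-DS). Here `L(E)` carries the topology of uniform convergence on bounded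
sets, so that `G` is an `L(E)`-valued distribution on `ℝ`. -/
structure IsPreCDS (C : E →L[ℂ] E) (G : TestFn →L[ℂ] (E →L[ℂ] E)) : Prop where
  /-- the support of `G` is contained in `[0, ∞)` -/
  support : ∀ φ : TestFn, tsupport φ ⊆ Iio 0 → G φ = 0
  /-- `C G = G C` -/
  comm : ∀ φ : TestFn, C.comp (G φ) = (G φ).comp C
  /-- `G(φ *₀ ψ) C = G(φ) G(ψ)` for all test functions `φ`, `ψ` -/
  conv : ∀ φ ψ : TestFn, (G (convZero φ ψ)).comp C = (G φ).comp (G ψ)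

/-- `e^{-wt} G` is tempered: the `L(E)`-valued distribution `φ ↦ G(e^{-w·} φ)` extends to a
continuous linear map on the Schwartz space. -/
def IsTemperedTwist (w : ℝ) (G : TestFn →L[ℂ] (E →L[ℂ] E)) : Prop :=
  ∃ H : 𝓢(ℝ, ℂ) →L[ℂ] (E →L[ℂ] E), ∀ φ : TestFn, H (toSchwartz φ) = G (expMul w φ)

/-- `G` is an exponential pre-(C-DS). -/
def IsPreCEDS (C : E →L[ℂ] E) (G : TestFn →L[ℂ] (E →L[ℂ] E)) : Prop :=
  IsPreCDS C G ∧ ∃ w : ℝ, IsTemperedTwist w G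

/-- The (integral) generator `G(-δ')` of `G`: all pairs `(x, y)` such that
`G((-δ') * φ) x = G(φ) y` for all test functions `φ` with support in `[0, ∞)`;
note that `(-δ') * φ = -φ'`. -/
def generator (G : TestFn →L[ℂ] (E →L[ℂ] E)) : Submodule ℂ (E × E) where
  carrier := {p | ∀ φ : TestFn, tsupport φ ⊆ Ici 0 → G (-(∂_{(1 : ℝ)} φ)) p.1 = G φ p.2}
  zero_mem' := by
    intro φ _
    simp
  add_mem' := by
    intro p q hp hq φ hφ
    simp only [Prod.fst_add, Prod.snd_add, map_add (G _), hp φ hφ, hq φ hφ]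
  smul_mem' := by
    intro c p hp φ hφ
    simp only [Prod.smul_fst, Prod.smul_snd, map_smul (G _), hp φ hφ]

end Distribution

end CDS

end

noncomputable section

namespace CDS

/-!
Since `W^α_+ φ = (-1)^n W^{-(n-α)} φ^{(n)}` is a Weyl integral of `φ^{(n)}`, bounding
`e^{(w+1)t} φ^{(n)}(t)` in the sup norm bounds `e^{(w+1)t} W^α_+ φ(t)`. Hence `G(φ) x` is an
absolutely convergent integral for each continuous seminorm, and `G` factors through bounded
continuous functions: by `φ ↦ e^{(w+1)t} φ^{(n)}` on test functions, and, after multiplication by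
`e^{-(w+1)t}`, by the map `f ↦ (d/dt - (w+1))^n f`, which is continuous on the Schwartz space.

The convolution law may be tested with continuous functionals, which turns it into the equality of
two densities on `[0, ∞)` paired with `h(r) = f(S(r) C x)`. For the Riemann–Liouville integrals `h`
of exponentials, that is, for the scalar integrated semigroups, the composition law reads
`h(t) h(s)` and both pairings are equal to the product of the Laplace integrals of `φ` and `ψ`. By
duality and Stone–Weierstrass a compactly supported integrable density is determined by its
pairings with these functions, so the densities agree and the law holds for every `h`.

The inclusion of the generators is an integration by parts.
-/

/-! ### Fractional integrals -/

theorem measurable_gKer (α : ℝ) : Measurable (gKer α) := by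
  unfold gKer
  fun_prop

theorem gKer_nonneg {α t : ℝ} (hα : 0 < α) (ht : 0 ≤ t) : 0 ≤ gKer α t :=
  div_nonneg (Real.rpow_nonneg ht _) (Real.Gamma_pos_of_pos hα).le

theorem continuousOn_gKer (α : ℝ) : ContinuousOn (gKer α) (Ioi 0) :=
  (continuousOn_id.rpow_const fun _ hx => Or.inl (ne_of_gt hx)).div_const _

theorem intervalIntegrable_gKer {α : ℝ} (hα : 0 < α) (a b : ℝ) :
    IntervalIntegrable (gKer α) volume a b :=
  (intervalIntegral.intervalIntegrable_rpow' (by linarith)).div_const _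

theorem integrableOn_Ioc_gKer {α : ℝ} (hα : 0 < α) (R : ℝ) :
    IntegrableOn (fun u => (gKer α u : ℂ)) (Ioc 0 R) :=
  (intervalIntegrable_gKer hα 0 R).1.ofReal

theorem gKer_nat_add_one (m : ℕ) (t : ℝ) : gKer (m + 1) t = t ^ m / m.factorial := by
  simp [gKer, Real.Gamma_nat_eq_factorial]

theorem gKer_one (t : ℝ) : gKer 1 t = 1 := by simp [gKer]

theorem ofReal_gKer (α : ℝ) {t : ℝ} (ht : 0 ≤ t) :
    (gKer α t : ℂ) = (t : ℂ) ^ ((α : ℂ) - 1) / Complex.Gamma α := by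
  rw [gKer, Complex.ofReal_div, Complex.ofReal_cpow ht, Complex.Gamma_ofReal]
  push_cast
  rfl

/-- The Weyl fractional integral of order `β`; order `0` has to be singled out, since `gKer 0`
is not the Dirac mass. -/
def weylInt (β : ℝ) (f : ℝ → ℂ) (t : ℝ) : ℂ :=
  if β = 0 then f t else ∫ u in Ioi 0, (gKer β u : ℂ) * f (t + u)

/-- The Riemann–Liouville fractional integral of order `α`, based at `0`. -/
def rlInt (α : ℝ) (k : ℝ → ℂ) (t : ℝ) : ℂ :=
  if α = 0 then k t else ∫ u in (0 : ℝ)..t, (gKer α (t - u) : ℂ) * k u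

theorem weylInt_zero (f : ℝ → ℂ) : weylInt 0 f = f := by ext; simp [weylInt]

theorem rlInt_zero (f : ℝ → ℂ) : rlInt 0 f = f := by ext; simp [rlInt]

theorem weylInt_of_pos {β : ℝ} (hβ : 0 < β) (f : ℝ → ℂ) (t : ℝ) :
    weylInt β f t = ∫ u in Ioi 0, (gKer β u : ℂ) * f (t + u) := if_neg hβ.ne'

theorem rlInt_of_pos {α : ℝ} (hα : 0 < α) (k : ℝ → ℂ) (t : ℝ) :
    rlInt α k t = ∫ u in (0 : ℝ)..t, (gKer α (t - u) : ℂ) * k u := if_neg hα.ne'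

theorem rlInt_gKer {a b z : ℝ} (ha : 0 < a) (hb : 0 < b) (hz : 0 < z) :
    rlInt a (fun u => (gKer b u : ℂ)) z = gKer (a + b) z := by
  have hkernels : ∀ u ∈ uIcc 0 z, (gKer a (z - u) : ℂ) * (gKer b u : ℂ) =
      (u : ℂ) ^ ((b : ℂ) - 1) * ((z : ℂ) - u) ^ ((a : ℂ) - 1) /
        (Complex.Gamma b * Complex.Gamma a) := by
    intro u hu
    rw [uIcc_of_le hz.le] at hu
    rw [ofReal_gKer a (sub_nonneg.2 hu.2), ofReal_gKer b hu.1, Complex.ofReal_sub]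
    field_simp
  have hΓa : Complex.Gamma a ≠ 0 := Complex.Gamma_ne_zero_of_re_pos (by simpa using ha)
  have hΓb : Complex.Gamma b ≠ 0 := Complex.Gamma_ne_zero_of_re_pos (by simpa using hb)
  rw [rlInt_of_pos ha, intervalIntegral.integral_congr hkernels, intervalIntegral.integral_div,
    Complex.betaIntegral_scaled _ _ hz,
    Complex.betaIntegral_eq_Gamma_mul_div _ _ (by simpa using hb) (by simpa using ha),
    ofReal_gKer _ hz.le, Complex.ofReal_add, add_comm (a : ℂ)]
  field_simp

theorem rlInt_one_right {α : ℝ} (hα : 0 ≤ α) {t : ℝ} (ht : 0 < t) :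
    rlInt α (fun _ => 1) t = (gKer (α + 1) t : ℂ) := by
  rcases hα.eq_or_lt with rfl | hα
  · simp [rlInt_zero, gKer_one]
  · simpa [gKer_one] using rlInt_gKer hα one_pos ht

theorem weylInt_const_mul (β : ℝ) (c : ℂ) (f : ℝ → ℂ) :
    weylInt β (fun t => c * f t) = fun t => c * weylInt β f t := by
  ext t
  unfold weylInt
  split_ifs
  · rfl
  · simp_rw [mul_left_comm _ c, integral_const_mul]

theorem weylInt_comp_add (β : ℝ) (f : ℝ → ℂ) (s t : ℝ) :
    weylInt β (fun z => f (s + z)) t = weylInt β f (s + t) := by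
  simp [weylInt, add_assoc]

theorem eqOn_weylInt_zero (β : ℝ) {f : ℝ → ℂ} {R : ℝ} (hf : EqOn f 0 (Ioi R)) :
    EqOn (weylInt β f) 0 (Ioi R) := by
  intro t ht
  unfold weylInt
  split_ifs
  · exact hf ht
  · refine setIntegral_eq_zero_of_forall_eq_zero fun u hu => ?_
    rw [hf (ht.trans (lt_add_of_pos_right t hu)), Pi.zero_apply, mul_zero]

/-! ### Duality of the fractional integrals -/

theorem integral_Ioi_eq_integral_Ioc {F : ℝ → ℂ} {R : ℝ} (hF : EqOn F 0 (Ioi R)) :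
    ∫ t in Ioi 0, F t = ∫ t in Ioc 0 R, F t :=
  setIntegral_eq_of_subset_of_forall_sdiff_eq_zero measurableSet_Ioi Ioc_subset_Ioi_self
    fun _ ht => hF (not_le.1 fun h => ht.2 ⟨ht.1, h⟩)

theorem integrable_mul_comp_sub_mul {f κ k : ℝ → ℂ} {c : ℝ} (hf : Integrable f)
    (hκ : Integrable κ) (hk : AEStronglyMeasurable k) (hkc : ∀ u, ‖k u‖ ≤ c) :
    Integrable (fun p : ℝ × ℝ => f p.1 * κ (p.1 - p.2) * k p.2) (volume.prod volume) := by
  have h := (hf.convolution_integrand (ContinuousLinearMap.mul ℝ ℂ) hκ.comp_neg).swap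
  refine (h.mul_bdd hk.comp_snd (Eventually.of_forall fun p => hkc p.2)).congr ?_
  exact Eventually.of_forall fun p => by simp

theorem aestronglyMeasurable_indicator_Ioc {k : ℝ → ℂ} {R : ℝ}
    (hk : ContinuousOn k (Icc 0 R)) : AEStronglyMeasurable ((Ioc 0 R).indicator k) volume :=
  (aestronglyMeasurable_indicator_iff measurableSet_Ioc).2
    ((hk.mono Ioc_subset_Icc_self).aestronglyMeasurable measurableSet_Ioc)

theorem exists_norm_indicator_Ioc_le {k : ℝ → ℂ} {R : ℝ} (hk : ContinuousOn k (Icc 0 R)) :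
    ∃ c, ∀ u, ‖(Ioc 0 R).indicator k u‖ ≤ c := by
  obtain ⟨c, hc⟩ := isCompact_Icc.exists_bound_of_continuousOn hk
  refine ⟨max c 0, fun u => ?_⟩
  by_cases hu : u ∈ Ioc 0 R
  · simpa [hu] using Or.inl (hc u (Ioc_subset_Icc_self hu))
  · simp [hu]

/-- The kernel `g_α` cut off to `(0, R)`, which makes it integrable. -/
def gCut (α R : ℝ) : ℝ → ℂ := (Ioo 0 R).indicator fun u => (gKer α u : ℂ)

theorem integrable_gCut {α : ℝ} (hα : 0 < α) (R : ℝ) : Integrable (gCut α R) :=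
  (integrable_indicator_iff measurableSet_Ioo).2
    ((integrableOn_Ioc_gKer hα R).mono_set Ioo_subset_Ioc_self)

section Duality

variable {α R : ℝ} {f k : ℝ → ℂ}

theorem integral_gCut_mul_indicator (hα : 0 < α) (k : ℝ → ℂ) {t : ℝ} (ht : t ∈ Ioc 0 R) :
    ∫ u, gCut α R (t - u) * (Ioc 0 R).indicator k u = rlInt α k t := by
  rw [rlInt_of_pos hα, intervalIntegral.integral_of_le ht.1.le, integral_Ioc_eq_integral_Ioo,
    ← integral_indicator measurableSet_Ioo]
  congr 1 with u
  by_cases hu : u ∈ Ioo 0 t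
  · rw [indicator_of_mem hu, gCut, indicator_of_mem, indicator_of_mem]
    · exact ⟨hu.1, hu.2.le.trans ht.2⟩
    · exact ⟨by linarith [hu.2], by linarith [hu.1, ht.2]⟩
  · rw [indicator_of_notMem hu]
    by_cases h0 : 0 < u
    · rw [gCut, indicator_of_notMem (fun h => hu ⟨h0, by linarith [h.1]⟩), zero_mul]
    · rw [indicator_of_notMem (fun h => h0 h.1), mul_zero]

theorem integral_indicator_mul_gCut (hα : 0 < α) (hf : EqOn f 0 (Ioi R)) {u : ℝ}
    (hu : u ∈ Ioc 0 R) :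
    ∫ t, (Ioc 0 R).indicator f t * gCut α R (t - u) = weylInt α f u := by
  rw [weylInt_of_pos hα, ← integral_add_right_eq_self _ u, ← integral_indicator measurableSet_Ioi]
  refine integral_congr_ae ?_
  filter_upwards [Measure.ae_ne volume (R - u)] with v hv
  rw [add_sub_cancel_right]
  by_cases h0 : 0 < v
  · rw [indicator_of_mem (mem_Ioi.2 h0)]
    by_cases h1 : v + u ≤ R
    · have hvR : v < R - u := lt_of_le_of_ne (by linarith) hv
      rw [indicator_of_mem (mem_Ioc.2 ⟨by linarith [hu.1], h1⟩), gCut,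
        indicator_of_mem (mem_Ioo.2 ⟨h0, by linarith [hu.1]⟩), add_comm v u, mul_comm]
    · rw [indicator_of_notMem fun h => h1 h.2, hf (show R < u + v by linarith)]
      simp
  · rw [indicator_of_notMem (notMem_Ioi.2 (not_lt.1 h0)), gCut,
      indicator_of_notMem (s := Ioo 0 R) (fun h => h0 h.1), mul_zero]

theorem setIntegral_mul_rlInt (hα : 0 < α) (hf : EqOn f 0 (Ioi R))
    (hint : Integrable (fun p : ℝ × ℝ => (Ioc 0 R).indicator f p.1 * gCut α R (p.1 - p.2) *
      (Ioc 0 R).indicator k p.2) (volume.prod volume)) :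
    ∫ t in Ioc 0 R, f t * rlInt α k t = ∫ u in Ioc 0 R, weylInt α f u * k u := by
  have hswap := integral_integral_swap (f := fun t u => (Ioc 0 R).indicator f t *
    gCut α R (t - u) * (Ioc 0 R).indicator k u) hint
  rw [← integral_indicator measurableSet_Ioc, ← integral_indicator measurableSet_Ioc]
  convert hswap using 1 <;> congr 1 with t
  · simp_rw [mul_assoc, integral_const_mul]
    by_cases ht : t ∈ Ioc 0 R
    · simp only [indicator_of_mem ht, integral_gCut_mul_indicator hα k ht]
    · simp [indicator_of_notMem ht]
  · rw [integral_mul_const]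
    by_cases ht : t ∈ Ioc 0 R
    · simp only [indicator_of_mem ht, integral_indicator_mul_gCut hα hf ht]
    · simp [indicator_of_notMem ht]

theorem integral_mul_rlInt (hα : 0 ≤ α) (hf : IntegrableOn f (Ioc 0 R))
    (hf0 : EqOn f 0 (Ioi R)) (hk : ContinuousOn k (Ici 0)) :
    ∫ t in Ioi 0, f t * rlInt α k t = ∫ u in Ioi 0, weylInt α f u * k u := by
  rcases hα.eq_or_lt with rfl | hα
  · simp [weylInt_zero, rlInt_zero]
  have hk' := hk.mono (Icc_subset_Ici_self : Icc 0 R ⊆ Ici 0)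
  obtain ⟨c, hc⟩ := exists_norm_indicator_Ioc_le hk'
  rw [integral_Ioi_eq_integral_Ioc (R := R) fun t ht => ?_,
    integral_Ioi_eq_integral_Ioc (R := R) fun t ht => ?_]
  · exact setIntegral_mul_rlInt hα hf0 (integrable_mul_comp_sub_mul
      (hf.integrable_indicator measurableSet_Ioc) (integrable_gCut hα R)
      (aestronglyMeasurable_indicator_Ioc hk') hc)
  · simp [eqOn_weylInt_zero α hf0 ht]
  · simp [hf0 ht]

theorem integrableOn_weylInt (hα : 0 < α) (hf : IntegrableOn f (Ioc 0 R))
    (hf0 : EqOn f 0 (Ioi R)) : IntegrableOn (weylInt α f) (Ioc 0 R) := by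
  have h := (integrable_mul_comp_sub_mul (k := fun _ => 1)
    (hf.integrable_indicator measurableSet_Ioc) (integrable_gCut hα R)
    aestronglyMeasurable_const (fun _ => norm_one.le)).integral_prod_right
  refine h.integrableOn.congr_fun (fun u hu => ?_) measurableSet_Ioc
  simpa only [mul_one] using integral_indicator_mul_gCut hα hf0 hu

/-- Duality, applied to the translate `z ↦ f (t + z)` and the kernel `gKer b`, reduces the
semigroup law of the Weyl integrals to that of the kernels. -/
theorem weylInt_weylInt {a b : ℝ} (ha : 0 ≤ a) (hb : 0 ≤ b) (hf : Continuous f)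
    (hf0 : EqOn f 0 (Ioi R)) : weylInt b (weylInt a f) = weylInt (a + b) f := by
  rcases ha.eq_or_lt with rfl | ha
  · rw [weylInt_zero, zero_add]
  rcases hb.eq_or_lt with rfl | hb
  · rw [weylInt_zero, add_zero]
  ext t
  have h0 : EqOn (fun z => f (t + z)) 0 (Ioi (R - t)) := fun z hz =>
    hf0 (mem_Ioi.2 (sub_lt_iff_lt_add'.1 hz))
  have hft : ContinuousOn (fun z => f (t + z)) (Icc 0 (R - t)) := by fun_prop
  obtain ⟨c, hc⟩ := exists_norm_indicator_Ioc_le hft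
  have hint := (integrable_mul_comp_sub_mul
    ((integrableOn_Ioc_gKer hb (R - t)).integrable_indicator measurableSet_Ioc)
    (integrable_gCut ha (R - t)).comp_neg (aestronglyMeasurable_indicator_Ioc hft) hc).swap
  have hdual := setIntegral_mul_rlInt (k := fun u => (gKer b u : ℂ)) ha h0
    (hint.congr (Eventually.of_forall fun p => by simp; ring))
  rw [weylInt_of_pos hb, weylInt_of_pos (add_pos ha hb),
    integral_Ioi_eq_integral_Ioc (R := R - t) fun z hz => ?_,
    integral_Ioi_eq_integral_Ioc (R := R - t) fun z hz => ?_]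
  · simp_rw [weylInt_comp_add, mul_comm (weylInt a f _)] at hdual
    rw [← hdual]
    refine setIntegral_congr_fun measurableSet_Ioc fun z hz => ?_
    rw [rlInt_gKer ha hb hz.1, mul_comm]
  · simp [show f (t + z) = 0 from h0 hz]
  · simp [eqOn_weylInt_zero a hf0 (mem_Ioi.2 (sub_lt_iff_lt_add'.1 hz))]

end Duality

/-! ### The Weyl fractional derivative -/

theorem exists_eqOn_zero_Ioi {f : ℝ → ℂ} (hf : HasCompactSupport f) : ∃ R, EqOn f 0 (Ioi R) := by
  obtain ⟨R, hR⟩ := hf.isBounded.bddAbove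
  exact ⟨R, fun t ht => image_eq_zero_of_notMem_tsupport fun h => ht.not_ge (hR h)⟩

theorem eqOn_iteratedDeriv_zero {f : ℝ → ℂ} {R : ℝ} (hf : EqOn f 0 (Ioi R)) (n : ℕ) :
    EqOn (iteratedDeriv n f) 0 (Ioi R) := by
  intro t ht
  rw [(hf.eventuallyEq_of_mem (Ioi_mem_nhds ht)).iteratedDeriv_eq]
  simp

theorem locallyIntegrable_reflect_gKer {β : ℝ} (hβ : 0 < β) :
    LocallyIntegrable ((Iio 0).indicator fun u => (gKer β (-u) : ℂ)) := by
  refine LocallyIntegrable.indicator (fun x => ⟨Ioc (x - 1) (x + 1), ?_, ?_⟩) measurableSet_Iio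
  · exact Ioc_mem_nhds (by linarith) (by linarith)
  · have h := (IntervalIntegrable.iff_comp_neg enorm_ne_top).1
      (intervalIntegrable_gKer hβ (-(x - 1)) (-(x + 1)))
    rw [neg_neg, neg_neg] at h
    exact h.1.ofReal

theorem weylInt_eq_convolution {β : ℝ} (hβ : 0 < β) (f : ℝ → ℂ) :
    weylInt β f = convolution ((Iio 0).indicator fun u => (gKer β (-u) : ℂ)) f
      (ContinuousLinearMap.mul ℝ ℂ) volume := by
  ext t
  rw [weylInt_of_pos hβ, convolution_def, ← integral_indicator measurableSet_Ioi,
    ← integral_neg_eq_self]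
  congr 1 with u
  simp [indicator, sub_eq_add_neg]

section Smooth

variable {f : ℝ → ℂ}

theorem hasCompactSupport_iteratedDeriv (hc : HasCompactSupport f) (n : ℕ) :
    HasCompactSupport (iteratedDeriv n f) := by
  induction n with
  | zero => rwa [iteratedDeriv_zero]
  | succ n ih => rw [iteratedDeriv_succ]; exact ih.deriv

theorem contDiff_iteratedDeriv (hf : ContDiff ℝ ∞ f) (n : ℕ) :
    ContDiff ℝ ∞ (iteratedDeriv n f) := by
  rw [iteratedDeriv_eq_iterate]
  exact hf.iterate_deriv n

theorem hasDerivAt_weylInt {β : ℝ} (hβ : 0 ≤ β) (hf : ContDiff ℝ 1 f)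
    (hc : HasCompactSupport f) (t : ℝ) :
    HasDerivAt (weylInt β f) (weylInt β (deriv f) t) t := by
  rcases hβ.eq_or_lt with rfl | hβ
  · simp_rw [weylInt_zero]
    exact (hf.differentiable one_ne_zero t).hasDerivAt
  · rw [weylInt_eq_convolution hβ, weylInt_eq_convolution hβ]
    exact hc.hasDerivAt_convolution_right _ (locallyIntegrable_reflect_gKer hβ) hf t

theorem iteratedDeriv_weylInt {β : ℝ} (hβ : 0 ≤ β) (hf : ContDiff ℝ ∞ f)
    (hc : HasCompactSupport f) (n : ℕ) :
    iteratedDeriv n (weylInt β f) = weylInt β (iteratedDeriv n f) := by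
  induction n with
  | zero => simp
  | succ n ih =>
    rw [iteratedDeriv_succ, ih, iteratedDeriv_succ]
    exact funext fun t => (hasDerivAt_weylInt hβ ((contDiff_iteratedDeriv hf n).of_le (by simp))
      (hasCompactSupport_iteratedDeriv hc n) t).deriv

theorem weylInt_one_deriv (hf : ContDiff ℝ 1 f) (hc : HasCompactSupport f) :
    weylInt 1 (deriv f) = fun t => -1 * f t := by
  ext t
  have hc' : HasCompactSupport fun u => f (t + u) := hc.comp_homeomorph (Homeomorph.addLeft t)
  have h := hc'.integral_Ioi_deriv_eq (hf.comp (contDiff_const.add contDiff_id)) 0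
  simpa [weylInt_of_pos one_pos, gKer_one, Function.comp_def, deriv_comp_const_add] using h

theorem weylInt_nat_iteratedDeriv (hf : ContDiff ℝ ∞ f) (hc : HasCompactSupport f) (n : ℕ) :
    weylInt n (iteratedDeriv n f) = fun t => (-1) ^ n * f t := by
  induction n with
  | zero => simp [weylInt_zero]
  | succ n ih =>
    obtain ⟨R, hR⟩ := exists_eqOn_zero_Ioi (hasCompactSupport_iteratedDeriv hc (n + 1))
    rw [Nat.cast_add, Nat.cast_one, add_comm, ← weylInt_weylInt zero_le_one n.cast_nonneg
      (contDiff_iteratedDeriv hf (n + 1)).continuous hR, iteratedDeriv_succ,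
      weylInt_one_deriv ((contDiff_iteratedDeriv hf n).of_le (by simp))
        (hasCompactSupport_iteratedDeriv hc n), weylInt_const_mul, ih]
    ext t
    ring

theorem integral_Ioi_rpow_sub_mul {β : ℝ} (hβ : 0 < β) (f : ℝ → ℂ) (r : ℝ) :
    ∫ s in Ioi r, (((s - r) ^ (β - 1) : ℝ) : ℂ) * f s =
      ((Real.Gamma β : ℝ) : ℂ) * weylInt β f r := by
  have hΓ : ((Real.Gamma β : ℝ) : ℂ) ≠ 0 := mod_cast (Real.Gamma_pos_of_pos hβ).ne'
  have h := (measurePreserving_add_left volume r).setIntegral_preimage_emb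
    (measurableEmbedding_addLeft r) (fun s => (((s - r) ^ (β - 1) : ℝ) : ℂ) * f s) (Ioi r)
  rw [preimage_const_add_Ioi, sub_self] at h
  rw [weylInt_of_pos hβ, ← integral_const_mul, ← h]
  congr 1 with u
  rw [add_sub_cancel_left, gKer]
  push_cast
  field_simp

theorem ceil_sub_nonneg (α : ℝ) : 0 ≤ (⌈α⌉₊ : ℝ) - α := sub_nonneg.2 (Nat.le_ceil α)

theorem weylDeriv_eq_weylInt (α : ℝ) (hf : ContDiff ℝ ∞ f) (hc : HasCompactSupport f) :
    weylDeriv α f = fun t => (-1) ^ ⌈α⌉₊ * weylInt (⌈α⌉₊ - α) (iteratedDeriv ⌈α⌉₊ f) t := by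
  ext t
  unfold weylDeriv
  split_ifs with h
  · rw [← h, sub_self, weylInt_zero]
  · have hpos : 0 < (⌈α⌉₊ : ℝ) - α := sub_pos.2 ((Nat.le_ceil α).lt_of_ne h)
    have hΓ : ((Real.Gamma (⌈α⌉₊ - α) : ℝ) : ℂ) ≠ 0 := mod_cast (Real.Gamma_pos_of_pos hpos).ne'
    simp_rw [integral_Ioi_rpow_sub_mul hpos]
    rw [iteratedDeriv_const_mul_field, iteratedDeriv_weylInt hpos.le hf hc]
    field_simp

theorem continuous_weylDeriv (α : ℝ) (hf : ContDiff ℝ ∞ f) (hc : HasCompactSupport f) :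
    Continuous (weylDeriv α f) := by
  rw [weylDeriv_eq_weylInt α hf hc]
  exact continuous_const.mul (continuous_iff_continuousAt.2 fun t =>
    (hasDerivAt_weylInt (ceil_sub_nonneg α) ((contDiff_iteratedDeriv hf _).of_le (by simp))
      (hasCompactSupport_iteratedDeriv hc _) t).continuousAt)

theorem eqOn_weylDeriv_zero (α : ℝ) (hf : ContDiff ℝ ∞ f) (hc : HasCompactSupport f) {R : ℝ}
    (hR : EqOn f 0 (Ioi R)) : EqOn (weylDeriv α f) 0 (Ioi R) := by
  intro t ht
  simp [weylDeriv_eq_weylInt α hf hc, eqOn_weylInt_zero _ (eqOn_iteratedDeriv_zero hR _) ht]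

theorem weylInt_weylDeriv {α : ℝ} (hα : 0 ≤ α) (hf : ContDiff ℝ ∞ f) (hc : HasCompactSupport f) :
    weylInt α (weylDeriv α f) = f := by
  obtain ⟨R, hR⟩ := exists_eqOn_zero_Ioi (hasCompactSupport_iteratedDeriv hc ⌈α⌉₊)
  rw [weylDeriv_eq_weylInt α hf hc, weylInt_const_mul,
    weylInt_weylInt (ceil_sub_nonneg α) hα (contDiff_iteratedDeriv hf _).continuous hR,
    sub_add_cancel, weylInt_nat_iteratedDeriv hf hc]
  ext t
  rw [← mul_assoc, ← mul_pow]
  simp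

theorem integrableOn_weylDeriv_mul (α : ℝ) (hf : ContDiff ℝ ∞ f) (hc : HasCompactSupport f)
    {k : ℝ → ℂ} (hk : ContinuousOn k (Ici 0)) :
    IntegrableOn (fun t => weylDeriv α f t * k t) (Ioi 0) := by
  obtain ⟨R, hR⟩ := exists_eqOn_zero_Ioi hc
  have hW := eqOn_weylDeriv_zero α hf hc hR
  have hIoc : IntegrableOn (fun t => weylDeriv α f t * k t) (Ioc 0 R) :=
    (((continuous_weylDeriv α hf hc).continuousOn.mul
      (hk.mono Icc_subset_Ici_self)).integrableOn_Icc).mono_set Ioc_subset_Icc_self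
  refine hIoc.of_forall_sdiff_eq_zero measurableSet_Ioi fun t ht => ?_
  have htR : R < t := not_le.1 fun h => ht.2 ⟨ht.1, h⟩
  simp [hW htR]

theorem integral_weylDeriv_mul_rlInt {α : ℝ} (hα : 0 ≤ α) (hf : ContDiff ℝ ∞ f)
    (hc : HasCompactSupport f) {k : ℝ → ℂ} (hk : ContinuousOn k (Ici 0)) :
    ∫ t in Ioi 0, weylDeriv α f t * rlInt α k t = ∫ t in Ioi 0, f t * k t := by
  obtain ⟨R, hR⟩ := exists_eqOn_zero_Ioi hc
  rw [integral_mul_rlInt hα (continuous_weylDeriv α hf hc).integrableOn_Ioc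
    (eqOn_weylDeriv_zero α hf hc hR) hk, weylInt_weylDeriv hα hf hc]

theorem weylInt_one_weylDeriv_deriv (α : ℝ) (hf : ContDiff ℝ ∞ f) (hc : HasCompactSupport f) :
    weylInt 1 (weylDeriv α (deriv f)) = fun t => -1 * weylDeriv α f t := by
  have hf' := (contDiff_infty_iff_deriv.1 hf).2
  have hcont := (contDiff_iteratedDeriv hf (⌈α⌉₊ + 1)).continuous
  obtain ⟨R, hR⟩ := exists_eqOn_zero_Ioi (hasCompactSupport_iteratedDeriv hc (⌈α⌉₊ + 1))
  rw [weylDeriv_eq_weylInt α hf hc, weylDeriv_eq_weylInt α hf' hc.deriv, ← iteratedDeriv_succ',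
    weylInt_const_mul, weylInt_weylInt (ceil_sub_nonneg α) zero_le_one hcont hR, add_comm,
    ← weylInt_weylInt zero_le_one (ceil_sub_nonneg α) hcont hR, iteratedDeriv_succ,
    weylInt_one_deriv ((contDiff_iteratedDeriv hf _).of_le (by simp))
      (hasCompactSupport_iteratedDeriv hc _), weylInt_const_mul]
  simp only [mul_left_comm]

theorem integral_weylDeriv_deriv_mul_rlInt_one (α : ℝ) (hf : ContDiff ℝ ∞ f)
    (hc : HasCompactSupport f) {k : ℝ → ℂ} (hk : ContinuousOn k (Ici 0)) :
    ∫ t in Ioi 0, weylDeriv α (deriv f) t * rlInt 1 k t =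
      -∫ t in Ioi 0, weylDeriv α f t * k t := by
  have hf' := (contDiff_infty_iff_deriv.1 hf).2
  obtain ⟨R, hR⟩ := exists_eqOn_zero_Ioi hc.deriv
  rw [integral_mul_rlInt zero_le_one (continuous_weylDeriv α hf' hc.deriv).integrableOn_Ioc
    (eqOn_weylDeriv_zero α hf' hc.deriv hR) hk, weylInt_one_weylDeriv_deriv α hf hc]
  simp only [neg_mul, one_mul, integral_neg]

theorem integral_weylDeriv_deriv_mul_gKer {α : ℝ} (hα : 0 ≤ α) (hf : ContDiff ℝ ∞ f)
    (hc : HasCompactSupport f) :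
    ∫ t in Ioi 0, weylDeriv α (deriv f) t * (gKer (α + 1) t : ℂ) = -f 0 := by
  have hf' := (contDiff_infty_iff_deriv.1 hf).2
  calc ∫ t in Ioi 0, weylDeriv α (deriv f) t * (gKer (α + 1) t : ℂ)
      = ∫ t in Ioi 0, weylDeriv α (deriv f) t * rlInt α (fun _ => 1) t :=
        setIntegral_congr_fun measurableSet_Ioi fun t ht => by
          simp only [rlInt_one_right hα (mem_Ioi.1 ht)]
    _ = ∫ t in Ioi 0, deriv f t := by
        simpa only [mul_one] using
          integral_weylDeriv_mul_rlInt hα hf' hc.deriv (k := fun _ => 1) continuousOn_const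
    _ = -f 0 := hc.integral_Ioi_deriv_eq (hf.of_le (by simp)) 0

end Smooth

/-! ### Densities determined by fractional integrals of exponentials -/

theorem integrableOn_mul_continuous {N g : ℝ → ℂ} {a b : ℝ} (hN : IntegrableOn N (Ioc a b))
    (hg : Continuous g) : IntegrableOn (fun u => N u * g u) (Ioc a b) :=
  hN.mul_continuousOn_of_subset hg.continuousOn measurableSet_Ioc isCompact_Icc
    Ioc_subset_Icc_self

section Moments

variable {a b : ℝ} {N : ℝ → ℂ} {θ : ℝ → ℝ}

theorem integral_mul_eval_eq_zero_of_moments (hN : IntegrableOn N (Ioc a b)) (hθ : Continuous θ)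
    (h : ∀ m : ℕ, ∫ u in Ioc a b, N u * ((θ u : ℂ) ^ m) = 0) (p : Polynomial ℝ) :
    ∫ u in Ioc a b, N u * ((p.eval (θ u) : ℝ) : ℂ) = 0 := by
  have hsum : ∀ u, N u * ((p.eval (θ u) : ℝ) : ℂ) =
      ∑ m ∈ Finset.range (p.natDegree + 1), (p.coeff m : ℂ) * (N u * (θ u : ℂ) ^ m) := by
    intro u
    rw [Polynomial.eval_eq_sum_range, Complex.ofReal_sum, Finset.mul_sum]
    refine Finset.sum_congr rfl fun m _ => ?_
    push_cast
    ring
  simp_rw [hsum]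
  rw [integral_finsetSum _ fun m _ => (integrableOn_mul_continuous hN (by fun_prop)).const_mul _]
  simp_rw [integral_const_mul, h, mul_zero, Finset.sum_const_zero]

theorem exists_polynomial_comp_near (hθ : Continuous θ) (hinj : InjOn θ (Icc a b)) {g : ℝ → ℝ}
    (hg : Continuous g) {ε : ℝ} (hε : 0 < ε) :
    ∃ p : Polynomial ℝ, ∀ u ∈ Icc a b, ‖g u - p.eval (θ u)‖ ≤ ε := by
  let Θ : C(Icc a b, ℝ) := ⟨fun x => θ x, by fun_prop⟩
  let g' : C(Icc a b, ℝ) := ⟨fun x => g x, by fun_prop⟩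
  have hsep : (Algebra.adjoin ℝ {Θ}).SeparatesPoints := fun x y hxy =>
    ⟨Θ, ⟨Θ, Algebra.self_mem_adjoin_singleton ℝ Θ, rfl⟩,
      fun he => hxy (Subtype.ext (hinj x.2 y.2 he))⟩
  obtain ⟨⟨q, hq⟩, hqg⟩ :=
    ContinuousMap.exists_mem_subalgebra_near_continuousMap_of_separatesPoints _ hsep g' ε hε
  rw [Algebra.adjoin_singleton_eq_range_aeval] at hq
  obtain ⟨p, rfl⟩ := hq
  refine ⟨p, fun u hu => ?_⟩
  have hu' := (ContinuousMap.norm_coe_le_norm _ (⟨u, hu⟩ : Icc a b)).trans hqg.le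
  rw [norm_sub_rev]
  simpa [Polynomial.aeval_continuousMap_apply, Θ, g'] using hu'

theorem integral_mul_eq_zero_of_moments (hN : IntegrableOn N (Ioc a b)) (hθ : Continuous θ)
    (hinj : InjOn θ (Icc a b)) (h : ∀ m : ℕ, ∫ u in Ioc a b, N u * (θ u : ℂ) ^ m = 0) {g : ℝ → ℝ}
    (hg : Continuous g) : ∫ u in Ioc a b, N u * (g u : ℂ) = 0 := by
  set I := ∫ u in Ioc a b, ‖N u‖
  have hI : 0 ≤ I := integral_nonneg fun _ => norm_nonneg _
  rw [← norm_le_zero_iff]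
  refine le_of_forall_pos_le_add fun ε hε => ?_
  obtain ⟨p, hp⟩ := exists_polynomial_comp_near hθ hinj hg (ε := ε / (I + 1)) (by positivity)
  have hsub : ∫ u in Ioc a b, N u * (g u : ℂ) =
      ∫ u in Ioc a b, (N u * (g u : ℂ) - N u * ((p.eval (θ u) : ℝ) : ℂ)) := by
    rw [integral_sub (integrableOn_mul_continuous hN (by fun_prop))
      (integrableOn_mul_continuous hN (by fun_prop)),
      integral_mul_eval_eq_zero_of_moments hN hθ h, sub_zero]
  calc ‖∫ u in Ioc a b, N u * (g u : ℂ)‖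
      ≤ ∫ u in Ioc a b, ‖N u‖ * (ε / (I + 1)) := by
        rw [hsub]
        refine norm_integral_le_of_norm_le (hN.norm.mul_const _) ?_
        filter_upwards [ae_restrict_mem measurableSet_Ioc] with u hu
        rw [← mul_sub, norm_mul, ← Complex.ofReal_sub, Complex.norm_real]
        gcongr
        exact hp u (Ioc_subset_Icc_self hu)
    _ = I / (I + 1) * ε := by rw [integral_mul_const]; ring
    _ ≤ 0 + ε := by
        rw [zero_add]
        exact mul_le_of_le_one_left hε.le (div_le_one_of_le₀ (by linarith) (by linarith))

theorem ae_eq_zero_of_forall_integral_mul_eq_zero (hN : IntegrableOn N (Ioc a b))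
    (h : ∀ g : ℝ → ℝ, Continuous g → ∫ u in Ioc a b, N u * (g u : ℂ) = 0) :
    ∀ᵐ u ∂volume.restrict (Ioc a b), N u = 0 := by
  refine (ae_restrict_iff' measurableSet_Ioc).2 ?_
  have hN' := hN.integrable_indicator measurableSet_Ioc
  have hzero := ae_eq_zero_of_integral_contDiff_smul_eq_zero hN'.locallyIntegrable
    fun g hg _ => by
      rw [← h g hg.continuous, ← integral_indicator measurableSet_Ioc]
      congr 1 with u
      by_cases hu : u ∈ Ioc a b <;> simp [hu, mul_comm]
  filter_upwards [hzero] with u hu hmem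
  rwa [indicator_of_mem hmem] at hu

end Moments

section RLExp

variable {α R : ℝ} {N : ℝ → ℂ}

theorem setIntegral_mul_rlInt_eq_weylInt_indicator (hα : 0 < α) (hN : IntegrableOn N (Ioc 0 R))
    {k : ℝ → ℂ} (hk : Continuous k) :
    ∫ u in Ioc 0 R, N u * rlInt α k u =
      ∫ u in Ioc 0 R, weylInt α ((Ioc 0 R).indicator N) u * k u := by
  have hN0 : EqOn ((Ioc 0 R).indicator N) 0 (Ioi R) := fun t ht =>
    indicator_of_notMem (fun h => (mem_Ioi.1 ht).not_ge h.2) _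
  have hdual := integral_mul_rlInt hα.le (hN.integrable_indicator measurableSet_Ioc).integrableOn
    hN0 hk.continuousOn
  rw [integral_Ioi_eq_integral_Ioc (R := R) fun t ht => by simp [hN0 ht],
    integral_Ioi_eq_integral_Ioc (R := R) fun t ht => by simp [eqOn_weylInt_zero α hN0 ht]] at hdual
  rw [← hdual]
  exact setIntegral_congr_fun measurableSet_Ioc fun u hu => by simp [hu]

theorem integral_mul_rlInt_eq_zero_of_exp (hα : 0 < α) (hN : IntegrableOn N (Ioc 0 R))
    (h : ∀ m : ℕ, ∫ u in Ioc 0 R, N u * rlInt α (fun v => Complex.exp (-m * v)) u = 0)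
    {k : ℝ → ℝ} (hk : Continuous k) :
    ∫ u in Ioc 0 R, N u * rlInt α (fun v => (k v : ℂ)) u = 0 := by
  have hW : IntegrableOn (weylInt α ((Ioc 0 R).indicator N)) (Ioc 0 R) :=
    integrableOn_weylInt hα (hN.integrable_indicator measurableSet_Ioc).integrableOn
      fun t ht => indicator_of_notMem (fun h => (mem_Ioi.1 ht).not_ge h.2) _
  rw [setIntegral_mul_rlInt_eq_weylInt_indicator hα hN (by fun_prop)]
  refine integral_mul_eq_zero_of_moments hW (θ := fun u => Real.exp (-u)) (by fun_prop)
    (fun x _ y _ hxy => by simpa using hxy) (fun m => ?_) hk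
  rw [← h m, setIntegral_mul_rlInt_eq_weylInt_indicator hα hN (by fun_prop)]
  congr 1 with u
  rw [← Complex.ofReal_pow, ← Real.exp_nat_mul, neg_mul_comm]
  push_cast
  rfl

theorem integral_mul_rpow_mul_pow_eq_zero (hα : 0 < α)
    (h : ∀ k : ℝ → ℝ, Continuous k → ∫ u in Ioc 0 R, N u * rlInt α (fun v => (k v : ℂ)) u = 0)
    (m : ℕ) : ∫ u in Ioc 0 R, N u * ((u ^ α : ℝ) : ℂ) * (u : ℂ) ^ m = 0 := by
  have hm : (0 : ℝ) < m + 1 := by positivity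
  have hΓ : ((Real.Gamma (α + m + 1) : ℝ) : ℂ) ≠ 0 :=
    mod_cast (Real.Gamma_pos_of_pos (by positivity)).ne'
  have hmonomial : ∀ u ∈ Ioc 0 R, N u * ((u ^ α : ℝ) : ℂ) * (u : ℂ) ^ m =
      ((Real.Gamma (α + m + 1) : ℝ) : ℂ) * (N u * rlInt α (fun v => (gKer (m + 1) v : ℂ)) u) := by
    intro u hu
    rw [rlInt_gKer hα hm hu.1, gKer, ← add_assoc, add_sub_cancel_right, Real.rpow_add hu.1,
      Real.rpow_natCast]
    push_cast
    field_simp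
  rw [setIntegral_congr_fun measurableSet_Ioc hmonomial, integral_const_mul,
    h _ (by simp_rw [funext (gKer_nat_add_one m)]; fun_prop), mul_zero]

/-- The Riemann–Liouville integrals of polynomials are the polynomials times `u ^ α`, so the
moments of `N u * u ^ α` vanish. -/
theorem ae_eq_zero_of_integral_rlInt_exp (hα : 0 < α) (hN : IntegrableOn N (Ioc 0 R))
    (h : ∀ m : ℕ, ∫ u in Ioc 0 R, N u * rlInt α (fun v => Complex.exp (-m * v)) u = 0) :
    ∀ᵐ u ∂volume.restrict (Ioc 0 R), N u = 0 := by
  have hNα : IntegrableOn (fun u => N u * ((u ^ α : ℝ) : ℂ)) (Ioc 0 R) :=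
    integrableOn_mul_continuous hN
      (Complex.continuous_ofReal.comp (Real.continuous_rpow_const hα.le))
  have hzero := ae_eq_zero_of_forall_integral_mul_eq_zero hNα fun g hg =>
    integral_mul_eq_zero_of_moments hNα continuous_id (injOn_id _)
      (integral_mul_rpow_mul_pow_eq_zero hα fun k hk =>
        integral_mul_rlInt_eq_zero_of_exp hα hN h hk) hg
  filter_upwards [hzero, ae_restrict_mem measurableSet_Ioc] with u hu hmem
  refine (mul_eq_zero.1 hu).resolve_right ?_
  exact mod_cast (Real.rpow_pos_of_pos hmem.1 α).ne'

end RLExp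

/-! ### The composition law of a scalar integrated semigroup -/

theorem primitive_mul_primitive {p : ℝ → ℂ} (hpc : ContinuousOn p (Ioi 0))
    (hpi : ∀ a b, IntervalIntegrable p volume a b) {t s : ℝ} (ht : 0 < t) (hs : 0 < s) :
    (∫ v in (0 : ℝ)..t, p v) * (∫ v in (0 : ℝ)..s, p v) =
      (∫ r in (0 : ℝ)..(t + s), p (t + s - r) * ∫ v in (0 : ℝ)..r, p v) -
      (∫ r in (0 : ℝ)..t, p (t + s - r) * ∫ v in (0 : ℝ)..r, p v) -
      (∫ r in (0 : ℝ)..s, p (t + s - r) * ∫ v in (0 : ℝ)..r, p v) := by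
  set P : ℝ → ℂ := fun r => ∫ v in (0 : ℝ)..r, p v
  have hP0 : P 0 = 0 := intervalIntegral.integral_same
  have hPc : Continuous P := intervalIntegral.continuous_primitive hpi 0
  have hPd : ∀ r, 0 < r → HasDerivAt P (p r) r := fun r hr =>
    intervalIntegral.integral_hasDerivAt_right (hpi 0 r)
      (hpc.stronglyMeasurableAtFilter isOpen_Ioi r hr) (hpc.continuousAt (Ioi_mem_nhds hr))
  have hi : ∀ a b, IntervalIntegrable (fun r => p r * P (t + s - r)) volume a b := fun a b =>
    (hpi a b).mul_continuousOn (by fun_prop)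
  have hi' : ∀ a b, IntervalIntegrable (fun r => p (t + s - r) * P r) volume a b := fun a b => by
    simpa only [sub_sub_cancel] using (hi (t + s - a) (t + s - b)).comp_sub_left (t + s)
  have hreflect : ∫ r in t..(t + s), p (t + s - r) * P r =
      ∫ v in (0 : ℝ)..s, p v * P (t + s - v) := by
    simpa using intervalIntegral.integral_comp_sub_left (a := t) (b := t + s)
      (fun v => p v * P (t + s - v)) (t + s)
  have hderiv : ∀ v ∈ Ioo 0 s, HasDerivAt (fun v => P v * P (t + s - v))
      (p v * P (t + s - v) - p (t + s - v) * P v) v := fun v hv =>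
    ((hPd v hv.1).mul ((hPd (t + s - v) (by linarith [hv.2])).comp_const_sub (t + s) v)).congr_deriv
      (by ring)
  rw [intervalIntegral.integral_interval_sub_left (hi' _ _) (hi' _ _), hreflect,
    ← intervalIntegral.integral_sub (hi _ _) (hi' _ _),
    intervalIntegral.integral_eq_sub_of_hasDerivAt_of_le hs.le (by fun_prop) hderiv
      ((hi _ _).sub (hi' _ _)), hP0, zero_mul, sub_zero, add_sub_cancel_right, mul_comm]

section Law

variable {α M : ℝ} {F G : ℝ → ℂ}

theorem intervalIntegrable_gKer_mul_exp (hα : 0 < α) (c : ℂ) (a b : ℝ) :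
    IntervalIntegrable (fun v => (gKer α v : ℂ) * Complex.exp (c * v)) volume a b :=
  IntervalIntegrable.mul_continuousOn
    ⟨(intervalIntegrable_gKer hα a b).1.ofReal, (intervalIntegrable_gKer hα a b).2.ofReal⟩
    (by fun_prop)

theorem rlInt_exp (hα : 0 < α) (c : ℂ) (r : ℝ) :
    rlInt α (fun v => Complex.exp (c * v)) r = Complex.exp (c * r) *
      ∫ v in (0 : ℝ)..r, (gKer α v : ℂ) * Complex.exp (-c * v) := by
  have hreflect := intervalIntegral.integral_comp_sub_left (a := 0) (b := r)
    (fun v => Complex.exp (c * r) * ((gKer α v : ℂ) * Complex.exp (-c * v))) r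
  rw [sub_self, sub_zero] at hreflect
  rw [rlInt_of_pos hα, ← intervalIntegral.integral_const_mul, ← hreflect]
  congr 1 with u
  rw [mul_left_comm, ← Complex.exp_add]
  push_cast
  ring_nf

theorem continuous_rlInt_exp (hα : 0 < α) (c : ℂ) :
    Continuous (rlInt α (fun v => Complex.exp (c * v))) := by
  rw [funext (rlInt_exp hα c)]
  exact (by fun_prop : Continuous fun r : ℝ => Complex.exp (c * r)).mul
    (intervalIntegral.continuous_primitive (intervalIntegrable_gKer_mul_exp hα (-c)) 0)

/-- The right-hand side of the composition law of an `α`-times integrated semigroup, with the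
scalar function `h` in the role of `r ↦ S(r) C x`. -/
def lawIntegral (α : ℝ) (h : ℝ → ℂ) (t s : ℝ) : ℂ :=
  (∫ r in Ioc 0 (t + s), (gKer α (t + s - r) : ℂ) * h r) -
  (∫ r in Ioc 0 t, (gKer α (t + s - r) : ℂ) * h r) -
  (∫ r in Ioc 0 s, (gKer α (t + s - r) : ℂ) * h r)

theorem lawIntegral_rlInt_exp (hα : 0 < α) (c : ℂ) {t s : ℝ} (ht : 0 < t) (hs : 0 < s) :
    lawIntegral α (rlInt α (fun v => Complex.exp (c * v))) t s =
      rlInt α (fun v => Complex.exp (c * v)) t * rlInt α (fun v => Complex.exp (c * v)) s := by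
  have hproduct := primitive_mul_primitive
    (p := fun v => (gKer α v : ℂ) * Complex.exp (-c * v))
    ((Complex.continuous_ofReal.comp_continuousOn (continuousOn_gKer α)).mul (by fun_prop))
    (intervalIntegrable_gKer_mul_exp hα (-c)) ht hs
  have hintegrand : ∀ r : ℝ, (gKer α (t + s - r) : ℂ) * rlInt α (fun v => Complex.exp (c * v)) r =
      Complex.exp (c * (t + s)) *
      ((gKer α (t + s - r) : ℂ) * Complex.exp (-c * (t + s - r : ℝ)) *
        ∫ v in (0 : ℝ)..r, (gKer α v : ℂ) * Complex.exp (-c * v)) := by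
    intro r
    have hexp : Complex.exp (c * r) =
        Complex.exp (c * (t + s)) * Complex.exp (-c * (t + s - r : ℝ)) := by
      rw [← Complex.exp_add]
      push_cast
      ring_nf
    rw [rlInt_exp hα, hexp]
    ring
  simp_rw [lawIntegral, hintegrand]
  rw [← intervalIntegral.integral_of_le (by positivity), ← intervalIntegral.integral_of_le ht.le,
    ← intervalIntegral.integral_of_le hs.le]
  simp only [intervalIntegral.integral_const_mul]
  rw [← mul_sub, ← mul_sub, ← hproduct, rlInt_exp hα, rlInt_exp hα, mul_add, Complex.exp_add]
  ring

/-- The kernel of `lawIntegral`. -/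
def lawKernel (α t s r : ℝ) : ℝ :=
  gKer α (t + s - r) *
    ((if r < t + s then 1 else 0) - (if r < t then 1 else 0) - (if r < s then 1 else 0))

theorem measurable_lawKernel (α : ℝ) :
    Measurable fun z : (ℝ × ℝ) × ℝ => lawKernel α z.1.1 z.1.2 z.2 := by
  unfold lawKernel
  refine ((measurable_gKer α).comp (by fun_prop)).mul (((Measurable.ite ?_ ?_ ?_).sub
    (Measurable.ite ?_ ?_ ?_)).sub (Measurable.ite ?_ ?_ ?_)) <;>
  first
  | exact measurable_const
  | exact measurableSet_lt (by fun_prop) (by fun_prop)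

theorem norm_lawKernel_le {t s r : ℝ} (ht : t ∈ Ioc 0 M) (hs : s ∈ Ioc 0 M) (hr : 0 < r) :
    ‖(lawKernel α t s r : ℂ)‖ ≤ 3 * ‖gCut α (M + M) (t + s - r)‖ := by
  rw [Complex.norm_real, lawKernel]
  by_cases h : r < t + s
  · have hmem : t + s - r ∈ Ioo 0 (M + M) := ⟨by linarith, by linarith [ht.2, hs.2]⟩
    rw [gCut, indicator_of_mem hmem, Complex.norm_real, norm_mul, mul_comm]
    gcongr
    split_ifs <;> norm_num
  · have hrt : ¬ r < t := fun h' => h (by linarith [hs.1])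
    have hrs : ¬ r < s := fun h' => h (by linarith [ht.1])
    simp [h, hrt, hrs]

theorem integrable_mul_comp_sub {X : Type*} [MeasurableSpace X] {μ : Measure X} [SFinite μ]
    {f : X → ℂ} {θ : X → ℝ} {κ : ℝ → ℂ} (hf : Integrable f μ) (hθ : Measurable θ)
    (hκ : Integrable κ) :
    Integrable (fun p : X × ℝ => f p.1 * κ (θ p.1 - p.2)) (μ.prod volume) := by
  have hshear : MeasurePreserving (fun p : X × ℝ => (p.1, θ p.1 - p.2))
      (μ.prod volume) (μ.prod volume) :=
    (MeasurePreserving.id μ).skew_product (g := fun x r => θ x - r) (by fun_prop)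
      (Eventually.of_forall fun x => (Measure.measurePreserving_sub_left volume (θ x)).map_eq)
  exact hshear.integrable_comp_of_integrable (hf.mul_prod hκ)

theorem integrable_mul_lawKernel (hα : 0 < α) (hF : IntegrableOn F (Ioc 0 M))
    (hG : IntegrableOn G (Ioc 0 M)) :
    Integrable (fun z : (ℝ × ℝ) × ℝ => F z.1.1 * G z.1.2 * (lawKernel α z.1.1 z.1.2 z.2 : ℂ))
      (((volume.restrict (Ioc 0 M)).prod (volume.restrict (Ioc 0 M))).prod
        (volume.restrict (Ioc 0 (M + M)))) := by
  have hFG := hF.mul_prod hG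
  have hdom := ((integrable_mul_comp_sub hFG (θ := fun p => p.1 + p.2) (by fun_prop)
    (integrable_gCut hα (M + M))).norm.const_mul 3).mono_measure
    (Measure.prod_mono le_rfl (Measure.restrict_le_self (s := Ioc 0 (M + M))))
  refine hdom.mono' (hFG.aestronglyMeasurable.comp_fst.mul
    (Complex.measurable_ofReal.comp (measurable_lawKernel α)).aestronglyMeasurable) ?_
  rw [Measure.prod_restrict, Measure.prod_restrict]
  filter_upwards [ae_restrict_mem ((measurableSet_Ioc.prod measurableSet_Ioc).prod
    measurableSet_Ioc)] with z hz
  rw [norm_mul, norm_mul (_ * _) (gCut _ _ _), mul_left_comm]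
  gcongr
  exact norm_lawKernel_le hz.1.1 hz.1.2 hz.2.1

theorem integral_lawKernel_mul (hα : 0 < α) {h : ℝ → ℂ} (hh : ContinuousOn h (Icc 0 (M + M)))
    {t s : ℝ} (ht : t ∈ Ioc 0 M) (hs : s ∈ Ioc 0 M) :
    ∫ r in Ioc 0 (M + M), (lawKernel α t s r : ℂ) * h r = lawIntegral α h t s := by
  set k : ℝ → ℂ := fun r => (gKer α (t + s - r) : ℂ) * h r
  have hM : 0 ≤ M + M := by linarith [ht.1, ht.2]
  have hk : IntegrableOn k (Ioc 0 (M + M)) := by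
    have hg := (intervalIntegrable_gKer hα (t + s) (t + s - (M + M))).comp_sub_left (t + s)
    rw [sub_self, sub_sub_cancel, intervalIntegrable_iff_integrableOn_Ioc_of_le hM] at hg
    exact IntegrableOn.mul_continuousOn_of_subset hg.ofReal hh measurableSet_Ioc isCompact_Icc
      Ioc_subset_Icc_self
  have hcut : ∀ c ≤ M + M, ∫ r in Ioc 0 (M + M), (Iio c).indicator k r = ∫ r in Ioc 0 c, k r := by
    intro c hc
    rw [setIntegral_indicator measurableSet_Iio, integral_Ioc_eq_integral_Ioo]
    congr 2
    ext r
    exact ⟨fun hr => ⟨hr.1.1, hr.2⟩, fun hr => ⟨⟨hr.1, hr.2.le.trans hc⟩, hr.2⟩⟩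
  have hik : ∀ c, IntegrableOn ((Iio c).indicator k) (Ioc 0 (M + M)) := fun c =>
    hk.indicator measurableSet_Iio
  rw [lawIntegral, ← hcut (t + s) (by linarith [ht.2, hs.2]), ← hcut t (by linarith [ht.1, ht.2]),
    ← hcut s (by linarith [hs.1, hs.2]), ← integral_sub (hik _) (hik _),
    ← integral_sub (by exact (hik _).sub (hik _)) (hik _)]
  congr 1 with r
  simp only [lawKernel, indicator, mem_Iio, k]
  split_ifs <;> push_cast <;> ring

/-- The density of the functional `h ↦ ∫∫ F(t) G(s) lawIntegral α h t s ds dt`, the integrals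
being taken over `(0, M]`. -/
def lawDensity (α M : ℝ) (F G : ℝ → ℂ) (r : ℝ) : ℂ :=
  ∫ p, F p.1 * G p.2 * (lawKernel α p.1 p.2 r : ℂ)
    ∂((volume.restrict (Ioc 0 M)).prod (volume.restrict (Ioc 0 M)))

theorem integrableOn_lawDensity (hα : 0 < α) (hF : IntegrableOn F (Ioc 0 M))
    (hG : IntegrableOn G (Ioc 0 M)) : IntegrableOn (lawDensity α M F G) (Ioc 0 (M + M)) :=
  (integrable_mul_lawKernel hα hF hG).integral_prod_right

theorem integral_integral_lawIntegral (hα : 0 < α) (hF : IntegrableOn F (Ioc 0 M))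
    (hG : IntegrableOn G (Ioc 0 M)) {h : ℝ → ℂ} (hh : ContinuousOn h (Icc 0 (M + M))) :
    ∫ t in Ioc 0 M, F t * ∫ s in Ioc 0 M, G s * lawIntegral α h t s =
      ∫ r in Ioc 0 (M + M), lawDensity α M F G r * h r := by
  set h' := (Ioc 0 (M + M)).indicator h
  obtain ⟨c, hc⟩ := exists_norm_indicator_Ioc_le hh
  have hint := (integrable_mul_lawKernel hα hF hG).mul_bdd (g := fun z => h' z.2)
    (aestronglyMeasurable_indicator_Ioc hh).restrict.comp_snd (Eventually.of_forall fun z => hc z.2)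
  have hlaw : ∀ t ∈ Ioc 0 M, ∀ s ∈ Ioc 0 M, F t * (G s * lawIntegral α h t s) =
      ∫ r in Ioc 0 (M + M), F t * G s * (lawKernel α t s r : ℂ) * h' r := by
    intro t ht s hs
    rw [← integral_lawKernel_mul hα hh ht hs, ← mul_assoc, ← integral_const_mul]
    refine setIntegral_congr_fun measurableSet_Ioc fun r hr => ?_
    simp only [h', indicator_of_mem hr, mul_assoc]
  calc ∫ t in Ioc 0 M, F t * ∫ s in Ioc 0 M, G s * lawIntegral α h t s
      = ∫ t in Ioc 0 M, ∫ s in Ioc 0 M, ∫ r in Ioc 0 (M + M),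
          F t * G s * (lawKernel α t s r : ℂ) * h' r := by
        refine setIntegral_congr_fun measurableSet_Ioc fun t ht => ?_
        rw [← integral_const_mul]
        exact setIntegral_congr_fun measurableSet_Ioc (hlaw t ht)
    _ = ∫ r in Ioc 0 (M + M), lawDensity α M F G r * h' r := by
        rw [← integral_prod _ hint.integral_prod_left, integral_integral_swap hint]
        simp_rw [lawDensity, integral_mul_const]
    _ = ∫ r in Ioc 0 (M + M), lawDensity α M F G r * h r :=
        setIntegral_congr_fun measurableSet_Ioc fun r hr => by simp only [h', indicator_of_mem hr]

end Law

/-! ### The composition law tested with Weyl derivatives -/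

theorem exists_eqOn_zero_Ioi_pair (φ ψ : TestFn) :
    ∃ M, EqOn φ 0 (Ioi M) ∧ EqOn ψ 0 (Ioi M) := by
  obtain ⟨R₁, h₁⟩ := exists_eqOn_zero_Ioi φ.hasCompactSupport
  obtain ⟨R₂, h₂⟩ := exists_eqOn_zero_Ioi ψ.hasCompactSupport
  exact ⟨max R₁ R₂, h₁.mono (Ioi_subset_Ioi (le_max_left _ _)),
    h₂.mono (Ioi_subset_Ioi (le_max_right _ _))⟩

theorem weylDeriv_zero (f : ℝ → ℂ) : weylDeriv 0 f = f := by
  ext t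
  simp [weylDeriv]

section ConvZero

variable {φ ψ : TestFn} {M : ℝ}

theorem eqOn_convZero_zero (hφ : EqOn φ 0 (Ioi M)) (hψ : EqOn ψ 0 (Ioi M)) :
    EqOn (convZero φ ψ) 0 (Ioi (M + M)) := by
  intro t ht
  refine intervalIntegral.integral_zero_ae (Eventually.of_forall fun s _ => ?_)
  rcases le_or_gt s M with h | h
  · rw [hφ (show M < t - s by linarith [mem_Ioi.1 ht]), Pi.zero_apply, zero_mul]
  · rw [hψ h, Pi.zero_apply, mul_zero]

theorem integral_convZero_mul_exp (φ ψ : TestFn) (c : ℂ) :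
    ∫ t in Ioi 0, convZero φ ψ t * Complex.exp (c * t) =
      (∫ t in Ioi 0, φ t * Complex.exp (c * t)) * ∫ t in Ioi 0, ψ t * Complex.exp (c * t) := by
  have hint : ∀ χ : TestFn, IntegrableOn (fun t => χ t * Complex.exp (c * t)) (Ioi 0) :=
    fun χ => (Continuous.integrable_of_hasCompactSupport
      (χ.continuous.mul (by fun_prop)) χ.hasCompactSupport.mul_right).integrableOn
  rw [mul_comm]
  refine Eq.trans ?_ (integral_posConvolution (hint ψ) (hint φ) (ContinuousLinearMap.mul ℝ ℂ))
  congr 1 with t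
  change (∫ s in (0 : ℝ)..t, φ (t - s) * ψ s) * _ = _
  rw [← intervalIntegral.integral_mul_const]
  congr 1 with s
  have hexp : Complex.exp (c * t) = Complex.exp (c * s) * Complex.exp (c * (t - s : ℝ)) := by
    rw [← Complex.exp_add]
    push_cast
    ring_nf
  rw [hexp, ContinuousLinearMap.mul_apply']
  ring

theorem integral_indicator_mul_indicator_comp_sub (φ ψ : TestFn) (r : ℝ) :
    ∫ t, (Ioi 0).indicator φ t * (Ioi 0).indicator ψ (r - t) =
      (Ioi 0).indicator (convZero φ ψ) r := by
  have hconv := congrFun (posConvolution_eq_convolution_indicator φ ψ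
    (ContinuousLinearMap.mul ℝ ℂ) volume) r
  rw [convolution_def] at hconv
  refine hconv.symm.trans (congrFun (indicator_congr fun r _ => ?_) r)
  have hreflect := intervalIntegral.integral_comp_sub_left (a := 0) (b := r)
    (fun s => φ (r - s) * ψ s) r
  simp only [sub_sub_cancel, sub_self, sub_zero] at hreflect
  exact hreflect

theorem integral_indicator_comp_sub_mul (hψ : EqOn ψ 0 (Ioi M)) (h : ℝ → ℂ) {t : ℝ}
    (ht : t ∈ Ioc 0 M) :
    ∫ r, (Ioi 0).indicator ψ (r - t) * (Ioc 0 (M + M)).indicator h r =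
      ∫ s in Ioi 0, ψ s * h (t + s) := by
  rw [← integral_indicator measurableSet_Ioi, ← integral_add_right_eq_self _ t]
  congr 1 with s
  rw [add_sub_cancel_right, add_comm s t]
  by_cases hs : 0 < s
  · rcases le_or_gt s M with hsM | hsM
    · have hmem : t + s ∈ Ioc 0 (M + M) := ⟨add_pos ht.1 hs, add_le_add ht.2 hsM⟩
      simp [hs, hmem]
    · simp [hs, hψ (mem_Ioi.2 hsM)]
  · simp [hs]

theorem integral_convZero (φ ψ : TestFn) {h : ℝ → ℂ} (hh : ContinuousOn h (Ici 0)) :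
    ∫ t in Ioi 0, φ t * ∫ s in Ioi 0, ψ s * h (t + s) =
      ∫ r in Ioi 0, convZero φ ψ r * h r := by
  obtain ⟨M, hφ, hψ⟩ := exists_eqOn_zero_Ioi_pair φ ψ
  have hh' := hh.mono (Icc_subset_Ici_self : Icc 0 (M + M) ⊆ Ici 0)
  obtain ⟨c, hc⟩ := exists_norm_indicator_Ioc_le hh'
  have hi : ∀ χ : TestFn, Integrable ((Ioi 0).indicator χ) := fun χ =>
    (χ.continuous.integrable_of_hasCompactSupport χ.hasCompactSupport).indicator measurableSet_Ioi
  have hint := integrable_mul_comp_sub_mul (hi φ) (hi ψ).comp_neg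
    (aestronglyMeasurable_indicator_Ioc hh') hc
  simp only [neg_sub] at hint
  calc ∫ t in Ioi 0, φ t * ∫ s in Ioi 0, ψ s * h (t + s)
      = ∫ t, ∫ r, (Ioi 0).indicator φ t * (Ioi 0).indicator ψ (r - t) *
          (Ioc 0 (M + M)).indicator h r := by
        rw [← integral_indicator measurableSet_Ioi]
        congr 1 with t
        simp_rw [mul_assoc, integral_const_mul]
        by_cases ht : t ∈ Ioc 0 M
        · simp [ht.1, integral_indicator_comp_sub_mul hψ h ht]
        · by_cases h0 : 0 < t
          · simp [h0, hφ (mem_Ioi.2 (not_le.1 fun hle => ht ⟨h0, hle⟩))]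
          · simp [h0]
    _ = ∫ r, (Ioi 0).indicator (convZero φ ψ) r * (Ioc 0 (M + M)).indicator h r := by
        rw [integral_integral_swap hint]
        simp_rw [integral_mul_const, integral_indicator_mul_indicator_comp_sub]
    _ = ∫ r in Ioi 0, convZero φ ψ r * h r := by
        rw [← integral_indicator measurableSet_Ioi]
        congr 1 with r
        by_cases h0 : 0 < r
        · rcases le_or_gt r (M + M) with hr | hr
          · simp [h0, hr]
          · simp [h0, eqOn_convZero_zero hφ hψ (mem_Ioi.2 hr)]
        · simp [h0]

end ConvZero

section Identity

variable {α M : ℝ} {φ ψ : TestFn}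

theorem integral_weylDeriv_mul_lawIntegral (hα : 0 < α) (hφ : EqOn φ 0 (Ioi M))
    (hψ : EqOn ψ 0 (Ioi M)) {h : ℝ → ℂ} (hh : ContinuousOn h (Ici 0)) :
    ∫ t in Ioi 0, weylDeriv α φ t * ∫ s in Ioi 0, weylDeriv α ψ s * lawIntegral α h t s =
      ∫ r in Ioc 0 (M + M), lawDensity α M (weylDeriv α φ) (weylDeriv α ψ) r * h r := by
  have hφ' := eqOn_weylDeriv_zero α φ.contDiff φ.hasCompactSupport hφ
  have hψ' := eqOn_weylDeriv_zero α ψ.contDiff ψ.hasCompactSupport hψ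
  rw [← integral_integral_lawIntegral hα
    (continuous_weylDeriv α φ.contDiff φ.hasCompactSupport).integrableOn_Ioc
    (continuous_weylDeriv α ψ.contDiff ψ.hasCompactSupport).integrableOn_Ioc
    (hh.mono Icc_subset_Ici_self),
    integral_Ioi_eq_integral_Ioc (R := M) fun t ht => by simp [hφ' ht]]
  congr 1 with t
  rw [integral_Ioi_eq_integral_Ioc (R := M) fun s hs => by simp [hψ' hs]]

theorem integral_weylDeriv_convZero_eq_Ioc (hφ : EqOn φ 0 (Ioi M)) (hψ : EqOn ψ 0 (Ioi M))
    (h : ℝ → ℂ) :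
    ∫ r in Ioi 0, weylDeriv α (convZero φ ψ) r * h r =
      ∫ r in Ioc 0 (M + M), weylDeriv α (convZero φ ψ) r * h r :=
  integral_Ioi_eq_integral_Ioc fun r hr => by
    simp [eqOn_weylDeriv_zero α (convZero φ ψ).contDiff (convZero φ ψ).hasCompactSupport
      (eqOn_convZero_zero hφ hψ) hr]

theorem integral_weylDeriv_mul_lawIntegral_rlInt_exp (hα : 0 < α) (φ ψ : TestFn) (c : ℂ) :
    ∫ t in Ioi 0, weylDeriv α φ t * ∫ s in Ioi 0, weylDeriv α ψ s *
        lawIntegral α (rlInt α fun v => Complex.exp (c * v)) t s =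
      ∫ r in Ioi 0, weylDeriv α (convZero φ ψ) r * rlInt α (fun v => Complex.exp (c * v)) r := by
  have hparts : ∀ χ : TestFn, ∫ t in Ioi 0, weylDeriv α χ t * rlInt α (fun v =>
      Complex.exp (c * v)) t = ∫ t in Ioi 0, χ t * Complex.exp (c * t) := fun χ =>
    integral_weylDeriv_mul_rlInt hα.le χ.contDiff χ.hasCompactSupport (by fun_prop)
  rw [hparts, integral_convZero_mul_exp, ← hparts, ← hparts, ← integral_mul_const]
  refine setIntegral_congr_fun measurableSet_Ioi fun t ht => ?_
  rw [mul_assoc, ← integral_const_mul (rlInt _ _ t)]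
  congr 1
  refine setIntegral_congr_fun measurableSet_Ioi fun s hs => ?_
  rw [lawIntegral_rlInt_exp hα c ht hs, mul_left_comm]

theorem lawDensity_weylDeriv_ae_eq (hα : 0 < α) (hφ : EqOn φ 0 (Ioi M)) (hψ : EqOn ψ 0 (Ioi M)) :
    ∀ᵐ r ∂volume.restrict (Ioc 0 (M + M)),
      lawDensity α M (weylDeriv α φ) (weylDeriv α ψ) r = weylDeriv α (convZero φ ψ) r := by
  have hW : ∀ χ : TestFn, ∀ R, IntegrableOn (weylDeriv α χ) (Ioc 0 R) := fun χ R =>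
    (continuous_weylDeriv α χ.contDiff χ.hasCompactSupport).integrableOn_Ioc
  have hD := integrableOn_lawDensity hα (hW φ M) (hW ψ M)
  have hzero := ae_eq_zero_of_integral_rlInt_exp hα (hD.sub (hW (convZero φ ψ) (M + M)))
    fun m => by
      have hq := continuous_rlInt_exp hα (-m)
      simp only [Pi.sub_apply, sub_mul]
      rw [integral_sub (integrableOn_mul_continuous hD hq)
        (integrableOn_mul_continuous (hW _ _) hq),
        ← integral_weylDeriv_mul_lawIntegral hα hφ hψ hq.continuousOn,
        ← integral_weylDeriv_convZero_eq_Ioc hφ hψ,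
        integral_weylDeriv_mul_lawIntegral_rlInt_exp hα, sub_self]
  filter_upwards [hzero] with r hr
  exact sub_eq_zero.1 hr

/-- The scalar form of the composition law of an `α`-times integrated `C`-semigroup for all
`α ≥ 0`: `f (S(t) S(s) x)` as a function of `h = (r ↦ f (S(r) C x))`. -/
def compLaw (α : ℝ) (h : ℝ → ℂ) (t s : ℝ) : ℂ :=
  if α = 0 then h (t + s) else lawIntegral α h t s

theorem integral_weylDeriv_mul_compLaw (hα : 0 ≤ α) (φ ψ : TestFn) {h : ℝ → ℂ}
    (hh : ContinuousOn h (Ici 0)) :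
    ∫ t in Ioi 0, weylDeriv α φ t * ∫ s in Ioi 0, weylDeriv α ψ s * compLaw α h t s =
      ∫ r in Ioi 0, weylDeriv α (convZero φ ψ) r * h r := by
  rcases hα.eq_or_lt with rfl | hα
  · simpa only [compLaw, if_true, weylDeriv_zero] using integral_convZero φ ψ hh
  obtain ⟨M, hφ, hψ⟩ := exists_eqOn_zero_Ioi_pair φ ψ
  simp only [compLaw, if_neg hα.ne']
  rw [integral_weylDeriv_mul_lawIntegral hα hφ hψ hh, integral_weylDeriv_convZero_eq_Ioc hφ hψ]
  refine integral_congr_ae ?_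
  filter_upwards [lawDensity_weylDeriv_ae_eq hα hφ hψ] with r hr
  rw [hr]

end Identity

/-! ### Integrals in sequentially complete locally convex spaces -/

open scoped ComplexOrder in
theorem polynormableSpace_of_locallyConvexSpace {E : Type*} [AddCommGroup E] [Module ℂ E]
    [TopologicalSpace E] [IsTopologicalAddGroup E] [ContinuousSMul ℂ E] [LocallyConvexSpace ℝ E] :
    PolynormableSpace ℂ E := by
  have : LocallyConvexSpace ℂ E :=
    LocallyConvexSpace.ofBasisZero ℂ E _ _ (LocallyConvexSpace.convex_basis_zero ℝ E)
      fun _ hs => convex_RCLike_iff_convex_real.2 hs.2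
  have : ContinuousSMul ℝ E := IsScalarTower.continuousSMul ℂ
  exact LocallyConvexSpace.toPolynormableSpace

section HasIntegral

variable {E : Type*} [AddCommGroup E] [Module ℂ E] {u v : ℝ → E} {μ : Measure ℝ} {y z : E}

section Additivity

variable [TopologicalSpace E]

theorem HasIntegral.congr (h : HasIntegral u μ y) (huv : u =ᵐ[μ] v) : HasIntegral v μ y := fun f =>
  have hf : (fun t => f (u t)) =ᵐ[μ] fun t => f (v t) := huv.fun_comp f
  ⟨(h f).1.congr hf, (integral_congr_ae hf).symm.trans (h f).2⟩

theorem HasIntegral.sub (hu : HasIntegral u μ y) (hv : HasIntegral v μ z) :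
    HasIntegral (fun t => u t - v t) μ (y - z) := fun f => by
  simp only [map_sub]
  exact ⟨(hu f).1.sub (hv f).1, by rw [integral_sub (hu f).1 (hv f).1, (hu f).2, (hv f).2]⟩

theorem HasIntegral.sum {ι : Type*} (s : Finset ι) {u : ι → ℝ → E} {y : ι → E}
    (h : ∀ i ∈ s, HasIntegral (u i) μ (y i)) :
    HasIntegral (fun t => ∑ i ∈ s, u i t) μ (∑ i ∈ s, y i) := fun f => by
  simp only [map_sum]
  exact ⟨integrable_finsetSum s fun i hi => (h i hi f).1, by
    rw [integral_finsetSum s fun i hi => (h i hi f).1]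
    exact Finset.sum_congr rfl fun i hi => (h i hi f).2⟩

theorem hasIntegral_indicator_const {s : Set ℝ} (hs : MeasurableSet s) (hμ : μ s ≠ ⊤) (x : E) :
    HasIntegral (s.indicator fun _ => x) μ ((μ.real s : ℂ) • x) := fun f => by
  have hf : (fun t => f (s.indicator (fun _ => x) t)) = s.indicator fun _ => f x := by
    ext t
    by_cases ht : t ∈ s <;> simp [ht]
  rw [hf, integrable_indicator_iff hs, integral_indicator_const _ hs, map_smul]
  exact ⟨integrableOn_const hμ, Complex.coe_smul _ _ |>.symm⟩

end Additivity

section Seminorm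

variable [TopologicalSpace E] [PolynormableSpace ℂ E]

theorem exists_dual_eq_seminorm {p : Seminorm ℂ E} (hp : Continuous p) (z : E) :
    ∃ f : E →L[ℂ] ℂ, ‖f z‖ = p z ∧ ∀ x, ‖f x‖ ≤ p x := by
  rcases eq_or_ne z 0 with rfl | hz
  · exact ⟨0, by simp, by simp⟩
  let e := LinearEquiv.coord ℂ E z hz
  have he : ∀ x : ℂ ∙ z, ‖((p z : ℂ) • e.toLinearMap) x‖ = p x := fun x => by
    conv_rhs => rw [← LinearEquiv.coord_apply_smul ℂ E z hz x, map_smul_eq_mul]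
    simp [e, abs_of_nonneg, mul_comm]
  obtain ⟨f, hf, hfp⟩ :=
    Module.Dual.exists_continuous_extension_of_le_seminorm _ _ hp fun x => (he x).le
  exact ⟨f, (congrArg norm (hf ⟨z, Submodule.mem_span_singleton_self z⟩)).trans (he _), hfp⟩

theorem eq_of_forall_dual_eq [T2Space E] (h : ∀ f : E →L[ℂ] ℂ, f y = f z) : y = z := by
  by_contra hne
  obtain ⟨p, hp⟩ := (PolynormableSpace.withSeminorms ℂ E).separating_of_T1 _ (sub_ne_zero.2 hne)
  obtain ⟨f, hf, -⟩ := exists_dual_eq_seminorm p.2 (y - z)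
  exact hp (by rw [Subtype.coe_mk, ← hf, map_sub, h, sub_self, norm_zero])

theorem HasIntegral.unique [T2Space E] (hy : HasIntegral u μ y) (hz : HasIntegral u μ z) : y = z :=
  eq_of_forall_dual_eq fun f => (hy f).2.symm.trans (hz f).2

theorem HasIntegral.seminorm_le (hy : HasIntegral u μ y) {p : Seminorm ℂ E} (hp : Continuous p)
    {b : ℝ → ℝ} (hb : Integrable b μ) (h : ∀ᵐ t ∂μ, p (u t) ≤ b t) : p y ≤ ∫ t, b t ∂μ := by
  obtain ⟨f, hf, hfp⟩ := exists_dual_eq_seminorm hp y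
  rw [← hf, ← (hy f).2]
  exact norm_integral_le_of_norm_le hb (h.mono fun t ht => (hfp _).trans ht)

end Seminorm

theorem hasIntegral_of_tendsto [TopologicalSpace E] {v : ℕ → ℝ → E} {y : ℕ → E}
    (hv : ∀ N, HasIntegral (v N) μ (y N)) (hy : Tendsto y atTop (𝓝 z))
    (hi : ∀ (f : E →L[ℂ] ℂ) N, Integrable (fun t => f (v N t - u t)) μ)
    (ht : ∀ f : E →L[ℂ] ℂ, Tendsto (fun N => ∫ t, ‖f (v N t - u t)‖ ∂μ) atTop (𝓝 0)) :
    HasIntegral u μ z := fun f => by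
  have hu : Integrable (fun t => f (u t)) μ :=
    ((hv 0 f).1.sub (hi f 0)).congr (Eventually.of_forall fun t => by simp)
  refine ⟨hu, tendsto_nhds_unique ?_ ((f.continuous.tendsto z).comp hy)⟩
  rw [tendsto_iff_norm_sub_tendsto_zero]
  refine squeeze_zero (fun _ => norm_nonneg _) (fun N => ?_) (ht f)
  simp only [Function.comp, ← (hv N f).2, ← integral_sub (hv N f).1 hu, ← map_sub]
  exact norm_integral_le_integral_norm _

theorem exists_hasIntegral_of_tendsto [UniformSpace E] [IsUniformAddGroup E] [PolynormableSpace ℂ E]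
    (hE : ∀ u : ℕ → E, CauchySeq u → ∃ x : E, Tendsto u atTop (𝓝 x)) {v : ℕ → ℝ → E} {y : ℕ → E}
    (hv : ∀ N, HasIntegral (v N) μ (y N))
    (hu : ∀ f : E →L[ℂ] ℂ, AEStronglyMeasurable (fun t => f (u t)) μ)
    (hi : ∀ p : Seminorm ℂ E, Continuous p → ∀ N, Integrable (fun t => p (v N t - u t)) μ)
    (ht : ∀ p : Seminorm ℂ E, Continuous p →
      Tendsto (fun N => ∫ t, p (v N t - u t) ∂μ) atTop (𝓝 0)) :
    ∃ z, HasIntegral u μ z := by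
  have hcauchy : CauchySeq y := by
    rw [cauchySeq_iff_tendsto, uniformity_eq_comap_nhds_zero, tendsto_comap_iff,
      (PolynormableSpace.withSeminorms ℂ E).tendsto_nhds]
    rintro ⟨p, hp⟩ ε hε
    have hN : ∀ᶠ N in atTop, ∫ t, p (v N t - u t) ∂μ < ε / 2 :=
      (ht p hp).eventually_lt_const (by positivity)
    rw [← prod_atTop_atTop_eq]
    filter_upwards [hN.prod_mk hN] with ⟨M, N⟩ ⟨hM, hN⟩
    have hle := ((hv N).sub (hv M)).seminorm_le hp
      (b := fun t => p (v N t - u t) + p (v M t - u t)) ((hi p hp N).add (hi p hp M))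
      (Eventually.of_forall fun t => by
        simpa only [sub_sub_sub_cancel_right] using map_sub_le_add p (v N t - u t) (v M t - u t))
    rw [integral_add (hi p hp N) (hi p hp M)] at hle
    simp only [Function.comp, Prod.map, sub_zero]
    linarith
  obtain ⟨z, hz⟩ := hE y hcauchy
  let dualSeminorm (f : E →L[ℂ] ℂ) : Seminorm ℂ E := (normSeminorm ℂ ℂ).comp f.toLinearMap
  have hf (f : E →L[ℂ] ℂ) : Continuous (dualSeminorm f) := f.continuous.norm
  refine ⟨z, hasIntegral_of_tendsto hv hz (fun f N => ?_) fun f => ht _ (hf f)⟩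
  refine (hi _ (hf f) N).mono' ?_ (Eventually.of_forall fun t => le_rfl)
  simp only [map_sub]
  exact (hv N f).1.aestronglyMeasurable.sub (hu f)

end HasIntegral

section StepApprox

/-- `t` rounded down to a multiple of `1 / (N + 1)`. -/
def gridFloor (N : ℕ) (t : ℝ) : ℝ := ⌊t * (N + 1)⌋₊ / (N + 1)

theorem measurable_gridFloor (N : ℕ) : Measurable (gridFloor N) :=
  (measurable_from_nat.comp (Nat.measurable_floor.comp (measurable_id.mul_const _))).div_const _

theorem gridFloor_nonneg (N : ℕ) (t : ℝ) : 0 ≤ gridFloor N t := by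
  unfold gridFloor
  positivity

theorem sub_one_le_gridFloor (N : ℕ) (t : ℝ) : t - 1 ≤ gridFloor N t := by
  rw [gridFloor, le_div_iff₀ (by positivity)]
  linarith [Nat.lt_floor_add_one (t * ((N : ℝ) + 1)), (Nat.cast_nonneg N : (0 : ℝ) ≤ N)]

theorem tendsto_gridFloor {t : ℝ} (ht : 0 ≤ t) : Tendsto (gridFloor · t) atTop (𝓝 t) :=
  (tendsto_nat_floor_mul_div_atTop ht).comp
    (tendsto_atTop_add_const_right _ _ tendsto_natCast_atTop_atTop)

variable {E : Type*} [AddCommGroup E]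

/-- The approximation of `u` on `[0, N + 1)` by a step function of mesh `1 / (N + 1)`. -/
def stepApprox (u : ℝ → E) (N : ℕ) (t : ℝ) : E :=
  if t < N + 1 then u (gridFloor N t) else 0

theorem stepApprox_eq_sum (u : ℝ → E) (N : ℕ) {t : ℝ} (ht : 0 ≤ t) :
    stepApprox u N t = ∑ i ∈ Finset.range ((N + 1) * (N + 1)),
      (Ico ((i : ℝ) / (N + 1)) ((i + 1) / (N + 1))).indicator (fun _ => u (i / (N + 1))) t := by
  have hN : (0 : ℝ) < N + 1 := by positivity
  have ht' : 0 ≤ t * (N + 1) := by positivity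
  have hmem (i : ℕ) : t ∈ Ico ((i : ℝ) / (N + 1)) ((i + 1) / (N + 1)) ↔ ⌊t * (N + 1)⌋₊ = i := by
    rw [Nat.floor_eq_iff ht', mem_Ico, div_le_iff₀ hN, lt_div_iff₀ hN]
  have hlt : ⌊t * (N + 1)⌋₊ ∈ Finset.range ((N + 1) * (N + 1)) ↔ t < N + 1 := by
    rw [Finset.mem_range, Nat.floor_lt ht']
    push_cast
    exact mul_lt_mul_iff_left₀ hN
  simp only [indicator_apply, hmem, Finset.sum_ite_eq, hlt, stepApprox, gridFloor]

theorem exists_hasIntegral_stepApprox [Module ℂ E] [TopologicalSpace E] (u : ℝ → E) (N : ℕ) :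
    ∃ y, HasIntegral (stepApprox u N) (volume.restrict (Ioi 0)) y := by
  have hsum := HasIntegral.sum (μ := volume.restrict (Ioi 0)) (Finset.range ((N + 1) * (N + 1)))
    fun i _ => hasIntegral_indicator_const (s := Ico ((i : ℝ) / (N + 1)) ((i + 1) / (N + 1)))
      measurableSet_Ico measure_Ico_lt_top.ne (u (i / (N + 1)))
  refine ⟨_, hsum.congr ?_⟩
  filter_upwards [ae_restrict_mem measurableSet_Ioi] with t ht
  exact (stepApprox_eq_sum u N (le_of_lt ht)).symm

variable [Module ℂ E] {u : ℝ → E} {p : Seminorm ℂ E} {D : ℝ}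

theorem seminorm_stepApprox_sub_le (hD : ∀ t, 0 ≤ t → p (u t) ≤ D * Real.exp (-t)) (N : ℕ)
    {t : ℝ} (ht : 0 ≤ t) :
    p (stepApprox u N t - u t) ≤ (D * Real.exp 1 + D) * Real.exp (-t) := by
  have hD0 : 0 ≤ D := by simpa using (apply_nonneg p _).trans (hD 0 le_rfl)
  rw [add_mul]
  refine (map_sub_le_add p _ _).trans (add_le_add ?_ (hD t ht))
  unfold stepApprox
  split_ifs
  · refine (hD _ (gridFloor_nonneg N t)).trans ?_
    rw [mul_assoc, ← Real.exp_add]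
    gcongr
    linarith [sub_one_le_gridFloor N t]
  · rw [map_zero]
    positivity

theorem norm_seminorm_stepApprox_sub_ae_le (hD : ∀ t, 0 ≤ t → p (u t) ≤ D * Real.exp (-t)) (N : ℕ) :
    ∀ᵐ t ∂volume.restrict (Ioi 0), ‖p (stepApprox u N t - u t)‖ ≤
      (D * Real.exp 1 + D) * Real.exp (-t) := by
  filter_upwards [ae_restrict_mem measurableSet_Ioi] with t ht
  rw [Real.norm_of_nonneg (apply_nonneg p _)]
  exact seminorm_stepApprox_sub_le hD N (le_of_lt ht)

variable [TopologicalSpace E] [IsTopologicalAddGroup E]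

theorem measurable_seminorm_stepApprox_sub (hu : Continuous u) (hp : Continuous p) (N : ℕ) :
    Measurable fun t => p (stepApprox u N t - u t) := by
  have hpu : Continuous fun z : ℝ × ℝ => p (u z.1 - u z.2) := by fun_prop
  have : (fun t => p (stepApprox u N t - u t)) =
      fun t : ℝ => if t < N + 1 then p (u (gridFloor N t) - u t) else p (u t) := by
    ext t
    unfold stepApprox
    split_ifs <;> simp
  rw [this]
  exact Measurable.ite measurableSet_Iio
    (hpu.measurable.comp ((measurable_gridFloor N).prodMk measurable_id)) (hp.comp hu).measurable

theorem tendsto_seminorm_stepApprox_sub (hu : Continuous u) (hp : Continuous p) {t : ℝ}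
    (ht : 0 ≤ t) : Tendsto (fun N => p (stepApprox u N t - u t)) atTop (𝓝 0) := by
  have hgrid : Tendsto (fun N => p (u (gridFloor N t) - u t)) atTop (𝓝 (p (u t - u t))) :=
    (hp.tendsto _).comp (((hu.tendsto t).comp (tendsto_gridFloor ht)).sub_const _)
  rw [sub_self, map_zero] at hgrid
  refine hgrid.congr' ?_
  filter_upwards [eventually_ge_atTop ⌈t⌉₊] with N hN
  have : t < N + 1 := (Nat.ceil_le.1 hN).trans_lt (lt_add_one _)
  rw [stepApprox, if_pos this]

theorem integrableOn_exp_neg : IntegrableOn (fun t => Real.exp (-t)) (Ioi 0) := by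
  simpa using integrableOn_exp_neg_Ioi (0 : ℝ)

theorem exists_hasIntegral {E : Type*} [AddCommGroup E] [Module ℂ E] [UniformSpace E]
    [IsUniformAddGroup E] [PolynormableSpace ℂ E]
    (hE : ∀ u : ℕ → E, CauchySeq u → ∃ x : E, Tendsto u atTop (𝓝 x)) {u : ℝ → E}
    (hu : ContinuousOn u (Ici 0)) (hb : ∀ p : Seminorm ℂ E, Continuous p →
      ∃ D : ℝ, ∀ t, 0 ≤ t → p (u t) ≤ D * Real.exp (-t)) :
    ∃ y, HasIntegral u (volume.restrict (Ioi 0)) y := by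
  wlog hc : Continuous u generalizing u
  · obtain ⟨y, hy⟩ := this (u := fun t => u (max t 0))
      (hu.comp (by fun_prop) fun t _ => le_max_right t 0)
      (fun p hp => (hb p hp).imp fun D hD t ht => by simpa only [max_eq_left ht] using hD t ht)
      (hu.comp_continuous (by fun_prop) fun t => le_max_right t 0)
    refine ⟨y, hy.congr ?_⟩
    filter_upwards [ae_restrict_mem measurableSet_Ioi] with t ht
    rw [max_eq_left (le_of_lt ht)]
  choose y hy using exists_hasIntegral_stepApprox u
  refine exists_hasIntegral_of_tendsto hE hy
    (fun f => (f.continuous.comp hc).aestronglyMeasurable) (fun p hp N => ?_) fun p hp => ?_ <;>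
    obtain ⟨D, hD⟩ := hb p hp
  · exact (integrableOn_exp_neg.const_mul _).mono'
      (measurable_seminorm_stepApprox_sub hc hp N).aestronglyMeasurable
      (norm_seminorm_stepApprox_sub_ae_le hD N)
  · simpa using tendsto_integral_of_dominated_convergence (f := fun _ => (0 : ℝ)) _
      (fun N => (measurable_seminorm_stepApprox_sub hc hp N).aestronglyMeasurable)
      (integrableOn_exp_neg.const_mul _) (norm_seminorm_stepApprox_sub_ae_le hD)
      ((ae_restrict_mem measurableSet_Ioi).mono fun t ht =>
        tendsto_seminorm_stepApprox_sub hc hp (le_of_lt ht))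

end StepApprox

/-! ### Exponentially weighted Weyl integrals -/

open BoundedContinuousFunction LineDeriv

section ExpWeylInt

variable {β w : ℝ}

/-- The Weyl integral of order `β` of `t ↦ e^{-wt} η(t)`. -/
def expWeylInt (β w : ℝ) (η : ℝ →ᵇ ℂ) : ℝ → ℂ :=
  weylInt β fun v => (Real.exp (-w * v) : ℂ) * η v

theorem integrableOn_gKer_mul_exp (hβ : 0 < β) (hw : 0 < w) :
    IntegrableOn (fun u => gKer β u * Real.exp (-w * u)) (Ioi 0) := by
  have h := integrableOn_rpow_mul_exp_neg_mul_rpow (p := 1) (s := β - 1) (by linarith) one_pos hw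
  simp only [Real.rpow_one] at h
  refine IntegrableOn.congr_fun (h.div_const (Real.Gamma β)) (fun u _ => ?_) measurableSet_Ioi
  simp only [gKer]
  ring

theorem expWeylInt_of_pos (hβ : 0 < β) (η : ℝ →ᵇ ℂ) (t : ℝ) :
    expWeylInt β w η t = (Real.exp (-w * t) : ℂ) *
      ∫ u in Ioi 0, ((gKer β u * Real.exp (-w * u) : ℝ) : ℂ) * η (t + u) := by
  rw [expWeylInt, weylInt_of_pos hβ, ← integral_const_mul]
  congr 1 with u
  rw [mul_add, Real.exp_add]
  push_cast
  ring

theorem norm_gKer_mul_exp_mul_ae_le (hβ : 0 < β) (η : ℝ →ᵇ ℂ) (t : ℝ) :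
    ∀ᵐ u ∂volume.restrict (Ioi 0), ‖((gKer β u * Real.exp (-w * u) : ℝ) : ℂ) * η (t + u)‖ ≤
      gKer β u * Real.exp (-w * u) * ‖η‖ := by
  filter_upwards [ae_restrict_mem measurableSet_Ioi] with u hu
  have h0 : 0 ≤ gKer β u * Real.exp (-w * u) :=
    mul_nonneg (gKer_nonneg hβ (le_of_lt hu)) (Real.exp_pos _).le
  rw [norm_mul, Complex.norm_real, Real.norm_of_nonneg h0]
  gcongr
  exact η.norm_coe_le_norm _

theorem aestronglyMeasurable_gKer_mul_exp_mul (η : ℝ →ᵇ ℂ) (t : ℝ) (μ : Measure ℝ) :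
    AEStronglyMeasurable (fun u => ((gKer β u * Real.exp (-w * u) : ℝ) : ℂ) * η (t + u)) μ :=
  (Complex.measurable_ofReal.comp ((measurable_gKer β).mul (by fun_prop))).aestronglyMeasurable.mul
    (η.continuous.comp (by fun_prop)).aestronglyMeasurable

theorem integrableOn_gKer_mul_exp_mul (hβ : 0 < β) (hw : 0 < w) (η : ℝ →ᵇ ℂ) (t : ℝ) :
    IntegrableOn (fun u => ((gKer β u * Real.exp (-w * u) : ℝ) : ℂ) * η (t + u)) (Ioi 0) :=
  ((integrableOn_gKer_mul_exp hβ hw).mul_const ‖η‖).mono'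
    (aestronglyMeasurable_gKer_mul_exp_mul η t _) (norm_gKer_mul_exp_mul_ae_le hβ η t)

theorem continuous_expWeylInt (hβ : 0 ≤ β) (hw : 0 < w) (η : ℝ →ᵇ ℂ) :
    Continuous (expWeylInt β w η) := by
  rcases hβ.eq_or_lt with rfl | hβ
  · rw [expWeylInt, weylInt_zero]
    fun_prop
  · rw [funext (expWeylInt_of_pos hβ η)]
    exact .mul (by fun_prop) <| continuous_of_dominated
      (fun t => aestronglyMeasurable_gKer_mul_exp_mul η t _) (norm_gKer_mul_exp_mul_ae_le hβ η)
      ((integrableOn_gKer_mul_exp hβ hw).mul_const ‖η‖) (.of_forall fun u => by fun_prop)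

theorem exists_norm_expWeylInt_le (hβ : 0 ≤ β) (hw : 0 < w) :
    ∃ A, 0 ≤ A ∧ ∀ (η : ℝ →ᵇ ℂ) (t : ℝ), ‖expWeylInt β w η t‖ ≤ A * ‖η‖ * Real.exp (-w * t) := by
  rcases hβ.eq_or_lt with rfl | hβ
  · refine ⟨1, zero_le_one, fun η t => ?_⟩
    rw [expWeylInt, weylInt_zero, norm_mul, Complex.norm_real,
      Real.norm_of_nonneg (Real.exp_pos _).le, one_mul, mul_comm]
    gcongr
    exact η.norm_coe_le_norm t
  · refine ⟨∫ u in Ioi 0, gKer β u * Real.exp (-w * u),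
      setIntegral_nonneg measurableSet_Ioi fun u hu =>
        mul_nonneg (gKer_nonneg hβ (le_of_lt hu)) (Real.exp_pos _).le, fun η t => ?_⟩
    rw [expWeylInt_of_pos hβ, norm_mul, Complex.norm_real,
      Real.norm_of_nonneg (Real.exp_pos _).le, mul_comm, ← integral_mul_const]
    gcongr
    exact norm_integral_le_of_norm_le ((integrableOn_gKer_mul_exp hβ hw).mul_const ‖η‖)
      (norm_gKer_mul_exp_mul_ae_le hβ η t)

theorem expWeylInt_add (hβ : 0 ≤ β) (hw : 0 < w) (η ξ : ℝ →ᵇ ℂ) (t : ℝ) :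
    expWeylInt β w (η + ξ) t = expWeylInt β w η t + expWeylInt β w ξ t := by
  rcases hβ.eq_or_lt with rfl | hβ
  · simp only [expWeylInt, weylInt_zero, BoundedContinuousFunction.add_apply, mul_add]
  · simp only [expWeylInt_of_pos hβ, BoundedContinuousFunction.add_apply, mul_add]
    rw [integral_add (integrableOn_gKer_mul_exp_mul hβ hw η t)
      (integrableOn_gKer_mul_exp_mul hβ hw ξ t), mul_add]

theorem expWeylInt_smul (c : ℂ) (η : ℝ →ᵇ ℂ) (t : ℝ) :
    expWeylInt β w (c • η) t = c * expWeylInt β w η t := by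
  simp only [expWeylInt, BoundedContinuousFunction.smul_apply, smul_eq_mul, mul_left_comm _ c,
    weylInt_const_mul]

end ExpWeylInt

/-! ### Integral operators with weighted Weyl integrals as kernels -/

section Operator

variable {E : Type*} [AddCommGroup E] [Module ℂ E]

theorem exists_clm_of_seminorm_le {V F : Type*} [SeminormedAddCommGroup V] [NormedSpace ℂ V]
    [TopologicalSpace E] [IsTopologicalAddGroup E] [PolynormableSpace ℂ E]
    [AddCommGroup F] [Module ℂ F] [TopologicalSpace F] [IsTopologicalAddGroup F]
    [ContinuousSMul ℂ F] [PolynormableSpace ℂ F] (J : V →ₗ[ℂ] E →ₗ[ℂ] F)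
    (hJ : ∀ p : Seminorm ℂ F, Continuous p → ∃ q : Seminorm ℂ E, Continuous q ∧
      ∀ η x, p (J η x) ≤ ‖η‖ * q x) :
    ∃ K : V →L[ℂ] E →L[ℂ] F, ∀ η x, K η x = J η x := by
  have hF := PolynormableSpace.withSeminorms ℂ F
  have hcont (η : V) : Continuous (J η) := hF.continuous_of_continuous_comp _ fun p => by
    obtain ⟨q, hq, hpq⟩ := hJ p p.2
    exact Seminorm.continuous_of_le (q := ‖η‖₊ • q) (hq.const_smul ‖η‖₊) (hpq η)
  let K : V →ₗ[ℂ] E →L[ℂ] F :=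
    { toFun := fun η => ⟨J η, hcont η⟩
      map_add' := fun η ξ => by ext x; simp
      map_smul' := fun c η => by ext x; simp }
  have hK : Continuous K := by
    refine continuous_of_continuousAt_zero K ?_
    rw [ContinuousAt, map_zero,
      (ContinuousLinearMap.hasBasis_nhds_zero_of_basis hF.hasBasis_zero_ball).tendsto_right_iff]
    rintro ⟨B, s, r⟩ ⟨hB, hr⟩
    have hball (p : {p : Seminorm ℂ F // Continuous p}) :
        ∀ᶠ η in 𝓝 (0 : V), ∀ x ∈ B, p.1 (K η x) < r := by
      obtain ⟨q, hq, hpq⟩ := hJ p p.2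
      obtain ⟨R, -, hR⟩ :=
        (PolynormableSpace.withSeminorms ℂ E).isVonNBounded_iff_seminorm_bounded.1 hB ⟨q, hq⟩
      have hlim : Tendsto (fun η : V => ‖η‖ * R) (𝓝 0) (𝓝 0) := by
        simpa using (tendsto_norm_zero (E := V)).mul_const R
      filter_upwards [hlim.eventually_lt_const hr] with η hη x hx
      exact (hpq η x).trans_lt
        ((mul_le_mul_of_nonneg_left (hR x hx).le (norm_nonneg η)).trans_lt hη)
    filter_upwards [(Filter.eventually_all_finset s).2 fun p _ => hball p] with η hη x hx
    exact (Seminorm.mem_ball_zero _).2 (Seminorm.finset_sup_apply_lt hr fun p hp => hη p hp x hx)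
  exact ⟨⟨K, hK⟩, fun _ _ => rfl⟩

/-- Seminorm form of the equicontinuity of `{e^{-wt} S(t) : t ≥ 0}`. -/
def IsExpBounded [TopologicalSpace E] (w : ℝ) (S : ℝ → E →L[ℂ] E) : Prop :=
  ∀ p : Seminorm ℂ E, Continuous p → ∃ q : Seminorm ℂ E, Continuous q ∧
    ∀ t, 0 ≤ t → ∀ x, p (S t x) ≤ Real.exp (w * t) * q x

theorem exists_seminorm_expWeylInt_smul_le [TopologicalSpace E] {S : ℝ → E →L[ℂ] E}
    {β w : ℝ} (hS : IsExpBounded w S) (hw : 0 ≤ w) (hβ : 0 ≤ β)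
    {p : Seminorm ℂ E} (hp : Continuous p) :
    ∃ q : Seminorm ℂ E, Continuous q ∧ ∀ (η : ℝ →ᵇ ℂ) (x : E) (t : ℝ), 0 ≤ t →
      p (expWeylInt β (w + 1) η t • S t x) ≤ ‖η‖ * q x * Real.exp (-t) := by
  obtain ⟨A, hA, hη⟩ := exists_norm_expWeylInt_le (w := w + 1) hβ (by linarith)
  obtain ⟨q, hq, hpq⟩ := hS p hp
  refine ⟨A.toNNReal • q, hq.const_smul A.toNNReal, fun η x t ht => ?_⟩
  rw [map_smul_eq_mul]
  calc ‖expWeylInt β (w + 1) η t‖ * p (S t x)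
      ≤ A * ‖η‖ * Real.exp (-(w + 1) * t) * (Real.exp (w * t) * q x) := by
        gcongr
        exacts [hη η t, hpq t ht x]
    _ = ‖η‖ * (A.toNNReal • q) x * Real.exp (-t) := by
        rw [_root_.smul_apply, NNReal.smul_def, Real.coe_toNNReal _ hA, smul_eq_mul,
          show -t = -(w + 1) * t + w * t by ring, Real.exp_add]
        ring

variable [UniformSpace E] [IsUniformAddGroup E] [ContinuousSMul ℂ E] [PolynormableSpace ℂ E]
  {S : ℝ → E →L[ℂ] E} {β w : ℝ}

theorem IsExpEquicontinuous.exists_isExpBounded (hS : IsExpEquicontinuous S) :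
    ∃ w, 0 ≤ w ∧ IsExpBounded w S := by
  obtain ⟨w, hw⟩ := hS
  let T (t : Ici (0 : ℝ)) : E →ₗ[ℂ] E := (Real.exp (-w * t) : ℂ) • (S t).toLinearMap
  have hT : UniformEquicontinuous (DFunLike.coe ∘ T) :=
    uniformEquicontinuous_of_equicontinuousAt_zero T (hw 0)
  have hE := PolynormableSpace.withSeminorms ℂ E
  rw [hE.uniformEquicontinuous_iff_exists_continuous_seminorm] at hT
  refine ⟨max w 0, le_max_right _ _, fun p hp => ?_⟩
  obtain ⟨q, hq, hpq⟩ := hT ⟨p, hp⟩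
  refine ⟨q, hq, fun t ht x => ?_⟩
  have hle : p ((Real.exp (-w * t) : ℂ) • S t x) ≤ q x := hpq ⟨t, ht⟩ x
  rw [map_smul_eq_mul, Complex.norm_real, Real.norm_of_nonneg (Real.exp_pos _).le, neg_mul,
    Real.exp_neg, inv_mul_le_iff₀ (Real.exp_pos _)] at hle
  refine hle.trans ?_
  gcongr
  exact le_max_left _ _

theorem exists_integralOperator [T2Space E]
    (hE : ∀ u : ℕ → E, CauchySeq u → ∃ x : E, Tendsto u atTop (𝓝 x))
    (hc : ∀ x : E, ContinuousOn (fun t => S t x) (Ici 0)) (hS : IsExpBounded w S) (hw : 0 ≤ w)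
    (hβ : 0 ≤ β) :
    ∃ J : (ℝ →ᵇ ℂ) →L[ℂ] E →L[ℂ] E, ∀ η x,
      HasIntegral (fun t => expWeylInt β (w + 1) η t • S t x) (volume.restrict (Ioi 0))
        (J η x) := by
  have hw' : 0 < w + 1 := by linarith
  have hex (η : ℝ →ᵇ ℂ) (x : E) : ∃ y,
      HasIntegral (fun t => expWeylInt β (w + 1) η t • S t x) (volume.restrict (Ioi 0)) y :=
    exists_hasIntegral hE ((continuous_expWeylInt hβ hw' η).continuousOn.smul (hc x)) fun p hp =>
      let ⟨q, _, hpq⟩ := exists_seminorm_expWeylInt_smul_le hS hw hβ hp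
      ⟨‖η‖ * q x, hpq η x⟩
  choose J hJ using hex
  obtain ⟨K, hK⟩ := exists_clm_of_seminorm_le
    (LinearMap.mk₂ ℂ J
      (fun η ξ x => (hJ _ x).unique (by
        simpa only [expWeylInt_add hβ hw', add_smul] using (hJ η x).add (hJ ξ x)))
      (fun c η x => (hJ _ x).unique (by
        simpa only [expWeylInt_smul, mul_smul] using (hJ η x).smul c))
      (fun η x y => (hJ η _).unique (by
        simpa only [map_add, smul_add] using (hJ η x).add (hJ η y)))
      fun c η x => (hJ η _).unique (by simpa only [map_smul, smul_comm c] using (hJ η x).smul c))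
    fun p hp => by
      obtain ⟨q, hq, hpq⟩ := exists_seminorm_expWeylInt_smul_le hS hw hβ hp
      refine ⟨q, hq, fun η x => ?_⟩
      simpa only [LinearMap.mk₂_apply, integral_const_mul, integral_exp_neg_Ioi_zero, mul_one] using
        (hJ η x).seminorm_le hp (integrableOn_exp_neg.const_mul (‖η‖ * q x))
          ((ae_restrict_mem measurableSet_Ioi).mono fun t ht => hpq η x t (le_of_lt ht))
  exact ⟨K, fun η x => by rw [hK]; exact hJ η x⟩

end Operator

/-! ### Twisted derivatives of test functions and Schwartz functions -/

section Twist

/-- `expMul w` as a continuous linear map. -/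
def expMulCLM (w : ℝ) : TestFn →L[ℂ] TestFn :=
  TestFunction.limitCLM ℂ (expMul w)
    (fun _ hK => (TestFunction.ofSupportedInCLM ℂ hK).comp
      (ContDiffMapSupportedIn.bilinLeftCLM (ContinuousLinearMap.mul ℂ ℂ).flip
        (g := fun t => (Real.exp (-w * t) : ℂ)) (Complex.ofRealCLM.contDiff.comp
          (Real.contDiff_exp.comp (contDiff_const.mul contDiff_id)))))
    fun _ _ _ => rfl

theorem coe_lineDeriv_testFn (φ : TestFn) : ⇑(∂_{(1 : ℝ)} φ : TestFn) = deriv φ := by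
  ext t
  rw [TestFunction.lineDerivOp_eq_lineDerivCLM ℝ, TestFunction.lineDerivCLM_apply_of_le (by simp),
    (φ.contDiff.differentiable (by simp)).differentiableAt.lineDeriv_eq_fderiv,
    fderiv_apply_one_eq_deriv]

theorem coe_lineDerivOpCLM_pow_testFn (n : ℕ) (φ : TestFn) :
    ⇑((lineDerivOpCLM ℂ TestFn (1 : ℝ) ^ n) φ) = iteratedDeriv n φ := by
  induction n with
  | zero => simp
  | succ n ih =>
    rw [pow_succ', iteratedDeriv_succ, ← ih, ← coe_lineDeriv_testFn]
    rfl

/-- The map `φ ↦ e^{wt} φ^{(n)}` from test functions to bounded continuous functions. -/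
def testTwist (w : ℝ) (n : ℕ) : TestFn →L[ℂ] (ℝ →ᵇ ℂ) :=
  (TestFunction.toBoundedContinuousFunctionCLM ℂ).comp
    ((expMulCLM (-w)).comp (lineDerivOpCLM ℂ TestFn (1 : ℝ) ^ n))

theorem testTwist_apply (w : ℝ) (n : ℕ) (φ : TestFn) (t : ℝ) :
    testTwist w n φ t = (Real.exp (w * t) : ℂ) * iteratedDeriv n φ t := by
  rw [← coe_lineDerivOpCLM_pow_testFn]
  conv_rhs => rw [← neg_neg w]
  rfl

theorem weylDeriv_eq_expWeylInt (α w : ℝ) (φ : TestFn) (t : ℝ) :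
    weylDeriv α φ t = (-1) ^ ⌈α⌉₊ * expWeylInt (⌈α⌉₊ - α) w (testTwist w ⌈α⌉₊ φ) t := by
  have hcancel (v : ℝ) :
      (Real.exp (-w * v) : ℂ) * testTwist w ⌈α⌉₊ φ v = iteratedDeriv ⌈α⌉₊ φ v := by
    rw [testTwist_apply, ← mul_assoc, ← Complex.ofReal_mul, ← Real.exp_add]
    simp
  simp only [weylDeriv_eq_weylInt α φ.contDiff φ.hasCompactSupport, expWeylInt, hcancel]

/-- The operator `d/dt - w` on Schwartz functions, which is the conjugate of `d/dt` by
multiplication by `e^{wt}`. -/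
def derivSub (w : ℝ) : 𝓢(ℝ, ℂ) →L[ℂ] 𝓢(ℝ, ℂ) :=
  SchwartzMap.derivCLM ℂ ℂ - (w : ℂ) • ContinuousLinearMap.id ℂ _

theorem deriv_exp_mul_schwartz (w : ℝ) (f : 𝓢(ℝ, ℂ)) :
    deriv (fun v => (Real.exp (-w * v) : ℂ) * f v) =
      fun v => (Real.exp (-w * v) : ℂ) * derivSub w f v := by
  ext v
  have hexp : HasDerivAt (fun v : ℝ => (Real.exp (-w * v) : ℂ)) (Real.exp (-w * v) * -w : ℝ) v :=
    (hasDerivAt_const_mul (-w)).exp.ofReal_comp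
  refine (hexp.mul (f.hasDerivAt v)).deriv.trans ?_
  change _ = _ * (deriv f v - (w : ℂ) * f v)
  push_cast
  ring

theorem derivSub_pow_apply (w : ℝ) (n : ℕ) (f : 𝓢(ℝ, ℂ)) (t : ℝ) :
    (derivSub w ^ n) f t = (Real.exp (w * t) : ℂ) *
      iteratedDeriv n (fun v => (Real.exp (-w * v) : ℂ) * f v) t := by
  induction n generalizing f with
  | zero =>
    rw [pow_zero, iteratedDeriv_zero, ← mul_assoc, ← Complex.ofReal_mul, ← Real.exp_add]
    simp
  | succ n ih =>
    rw [iteratedDeriv_succ', deriv_exp_mul_schwartz, ← ih, pow_succ]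
    rfl

/-- The map `f ↦ e^{wt} (e^{-wt} f)^{(n)}` from Schwartz functions to bounded continuous
functions. -/
def schwartzTwist (w : ℝ) (n : ℕ) : 𝓢(ℝ, ℂ) →L[ℂ] (ℝ →ᵇ ℂ) :=
  (SchwartzMap.toBoundedContinuousFunctionCLM ℂ ℝ ℂ).comp (derivSub w ^ n)

theorem schwartzTwist_toSchwartz (w : ℝ) (n : ℕ) (φ : TestFn) :
    schwartzTwist w n (toSchwartz φ) = testTwist w n (expMul w φ) := by
  ext t
  rw [testTwist_apply]
  exact derivSub_pow_apply w n (toSchwartz φ) t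

end Twist

/-! ### The Weyl integral of an integrated semigroup -/

section WeylIntegral

variable {E : Type*} [AddCommGroup E] [Module ℂ E]

/-- `G(φ) x = ∫_0^∞ W^α_+ φ(t) S(t) x dt` for all `φ` and `x`. -/
def IsWeylIntegral [TopologicalSpace E] [IsTopologicalAddGroup E] [ContinuousSMul ℂ E] (α : ℝ)
    (S : ℝ → E →L[ℂ] E) (G : TestFn →L[ℂ] E →L[ℂ] E) : Prop :=
  ∀ (φ : TestFn) x, HasIntegral (fun t => weylDeriv α φ t • S t x) (volume.restrict (Ioi 0)) (G φ x)

theorem exists_isWeylIntegral_isTemperedTwist [UniformSpace E] [IsUniformAddGroup E]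
    [ContinuousSMul ℂ E] [PolynormableSpace ℂ E] [T2Space E] {S : ℝ → E →L[ℂ] E}
    (hE : ∀ u : ℕ → E, CauchySeq u → ∃ x : E, Tendsto u atTop (𝓝 x)) (α : ℝ)
    (hc : ∀ x : E, ContinuousOn (fun t => S t x) (Ici 0)) (hexp : IsExpEquicontinuous S) :
    ∃ G : TestFn →L[ℂ] E →L[ℂ] E, IsWeylIntegral α S G ∧ ∃ w, IsTemperedTwist w G := by
  obtain ⟨w, hw, hS⟩ := hexp.exists_isExpBounded
  obtain ⟨J, hJ⟩ := exists_integralOperator hE hc hS hw (ceil_sub_nonneg α)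
  refine ⟨(-1 : ℂ) ^ ⌈α⌉₊ • J.comp (testTwist (w + 1) ⌈α⌉₊), fun φ x => ?_, w + 1,
    (-1 : ℂ) ^ ⌈α⌉₊ • J.comp (schwartzTwist (w + 1) ⌈α⌉₊), fun φ => ?_⟩
  · have h := (hJ (testTwist (w + 1) ⌈α⌉₊ φ) x).smul ((-1 : ℂ) ^ ⌈α⌉₊)
    simp only [← mul_smul, ← weylDeriv_eq_expWeylInt] at h
    exact h
  · change (-1 : ℂ) ^ ⌈α⌉₊ • J (schwartzTwist (w + 1) ⌈α⌉₊ (toSchwartz φ)) = _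
    rw [schwartzTwist_toSchwartz]
    rfl

theorem IsIntegratedSemigroup.apply_comp [TopologicalSpace E] {α : ℝ} {C : E →L[ℂ] E}
    {S : ℝ → E →L[ℂ] E} (hS : IsIntegratedSemigroup α C S) (hα : 0 ≤ α) {t s : ℝ} (ht : 0 ≤ t)
    (hs : 0 ≤ s) (x : E) (f : E →L[ℂ] ℂ) :
    f (S t (S s x)) = compLaw α (fun r => f (S r (C x))) t s := by
  rcases hα.eq_or_lt with rfl | hα
  · rw [hS.law_zero rfl t s ht hs, compLaw, if_pos rfl]
  · obtain ⟨y₁, y₂, y₃, hy₁, hy₂, hy₃, hy⟩ := hS.law_pos hα t s ht hs x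
    rw [hy, map_sub, map_sub, ← (hy₁ f).2, ← (hy₂ f).2, ← (hy₃ f).2, compLaw, if_neg hα.ne',
      lawIntegral]
    simp only [map_smul, smul_eq_mul]

namespace IsWeylIntegral

variable [TopologicalSpace E] [IsTopologicalAddGroup E] [ContinuousSMul ℂ E] {α : ℝ}
  {C : E →L[ℂ] E} {S : ℝ → E →L[ℂ] E} {G : TestFn →L[ℂ] E →L[ℂ] E}

theorem apply_eq (hG : IsWeylIntegral α S G) (φ : TestFn) (x : E) (f : E →L[ℂ] ℂ) :
    f (G φ x) = ∫ t in Ioi 0, weylDeriv α φ t * f (S t x) := by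
  simpa only [map_smul, smul_eq_mul] using (hG φ x f).2.symm

variable [PolynormableSpace ℂ E] [T2Space E]

theorem eq_zero_of_tsupport_subset (hG : IsWeylIntegral α S G) {φ : TestFn}
    (hφ : tsupport φ ⊆ Iio 0) : G φ = 0 := by
  have hW := eqOn_weylDeriv_zero α φ.contDiff φ.hasCompactSupport (R := 0) fun t ht =>
    image_eq_zero_of_notMem_tsupport fun h => lt_asymm (mem_Ioi.1 ht) (hφ h)
  ext x
  refine eq_of_forall_dual_eq fun f => ?_
  rw [hG.apply_eq, setIntegral_eq_zero_of_forall_eq_zero fun t ht => by simp [hW ht]]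
  simp

theorem comp_comm (hG : IsWeylIntegral α S G) (hSC : ∀ t, 0 ≤ t → ∀ x, S t (C x) = C (S t x))
    (φ : TestFn) : C.comp (G φ) = (G φ).comp C := by
  ext x
  refine eq_of_forall_dual_eq fun f => ?_
  change f.comp C (G φ x) = f (G φ (C x))
  rw [hG.apply_eq, hG.apply_eq]
  exact setIntegral_congr_fun measurableSet_Ioi fun t ht => by simp [hSC t (le_of_lt ht)]

theorem convZero_comp (hG : IsWeylIntegral α S G) (hα : 0 ≤ α) (hS : IsIntegratedSemigroup α C S)
    (φ ψ : TestFn) : (G (convZero φ ψ)).comp C = (G φ).comp (G ψ) := by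
  ext x
  refine eq_of_forall_dual_eq fun f => ?_
  have hcont : ContinuousOn (fun r => f (S r (C x))) (Ici 0) :=
    f.continuous.comp_continuousOn (hS.continuousOn (C x))
  calc f (G (convZero φ ψ) (C x))
      = ∫ r in Ioi 0, weylDeriv α (convZero φ ψ) r * f (S r (C x)) := hG.apply_eq _ _ f
    _ = ∫ t in Ioi 0, weylDeriv α φ t *
          ∫ s in Ioi 0, weylDeriv α ψ s * compLaw α (fun r => f (S r (C x))) t s :=
        (integral_weylDeriv_mul_compLaw hα φ ψ hcont).symm
    _ = ∫ t in Ioi 0, weylDeriv α φ t * ∫ s in Ioi 0, weylDeriv α ψ s * f (S t (S s x)) :=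
        setIntegral_congr_fun measurableSet_Ioi fun t ht => congrArg _ <|
          setIntegral_congr_fun measurableSet_Ioi fun s hs => by
            simp only [hS.apply_comp hα (le_of_lt ht) (le_of_lt hs)]
    _ = ∫ t in Ioi 0, weylDeriv α φ t * f (S t (G ψ x)) := by
        congr 1 with t
        exact congrArg _ (hG.apply_eq ψ x (f.comp (S t))).symm
    _ = f (G φ (G ψ x)) := (hG.apply_eq φ (G ψ x) f).symm

theorem isPreCDS (hG : IsWeylIntegral α S G) (hα : 0 ≤ α) (hS : IsIntegratedSemigroup α C S) :
    IsPreCDS C G where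
  support _ := hG.eq_zero_of_tsupport_subset
  comm := hG.comp_comm hS.comm
  conv := hG.convZero_comp hα hS

end IsWeylIntegral

/-! ### The integral generator -/

section Generator

variable [TopologicalSpace E] {α : ℝ} {C : E →L[ℂ] E} {S : ℝ → E →L[ℂ] E} {x y : E}

theorem apply_eq_of_mem_integralGenerator (hxy : (x, y) ∈ integralGenerator α C S) {t : ℝ}
    (ht : 0 ≤ t) (f : E →L[ℂ] ℂ) :
    f (S t x) = (gKer (α + 1) t : ℂ) * f (C x) + rlInt 1 (fun s => f (S s y)) t := by
  have h : ∫ s in Ioc 0 t, f (S s y) = f (S t x - (gKer (α + 1) t : ℂ) • C x) := (hxy t ht f).2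
  rw [map_sub, map_smul, smul_eq_mul] at h
  simp only [rlInt_of_pos one_pos, gKer_one, Complex.ofReal_one, one_mul,
    intervalIntegral.integral_of_le ht, h, add_sub_cancel]

theorem apply_zero_of_tsupport_subset_Ici {φ : ℝ → ℂ} (hφ : Continuous φ)
    (hsupp : tsupport φ ⊆ Ici 0) : φ 0 = 0 := by
  have hlim : Tendsto φ (𝓝[<] 0) (𝓝 (φ 0)) := hφ.continuousWithinAt
  refine tendsto_nhds_unique hlim (tendsto_const_nhds.congr' ?_)
  filter_upwards [self_mem_nhdsWithin] with t ht
  exact (image_eq_zero_of_notMem_tsupport fun h => not_le.2 (mem_Iio.1 ht) (hsupp h)).symm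

theorem integral_weylDeriv_deriv_mul_apply (hα : 0 ≤ α)
    (hc : ∀ x : E, ContinuousOn (fun t => S t x) (Ici 0))
    (hxy : (x, y) ∈ integralGenerator α C S) {φ : ℝ → ℂ} (hφ : ContDiff ℝ ∞ φ)
    (hφc : HasCompactSupport φ) (hφ0 : φ 0 = 0) (f : E →L[ℂ] ℂ) :
    ∫ t in Ioi 0, weylDeriv α (deriv φ) t * f (S t x) =
      -∫ t in Ioi 0, weylDeriv α φ t * f (S t y) := by
  have hφ' := (contDiff_infty_iff_deriv.1 hφ).2
  have hfS (z : E) : ContinuousOn (fun t => f (S t z)) (Ici 0) :=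
    f.continuous.comp_continuousOn (hc z)
  have hgKer : ContinuousOn (fun t => (gKer (α + 1) t : ℂ)) (Ici 0) :=
    Complex.continuous_ofReal.comp_continuousOn
      ((continuousOn_id.rpow_const fun t _ => .inr (by linarith)).div_const _)
  have hint {k : ℝ → ℂ} (hk : ContinuousOn k (Ici 0)) :=
    integrableOn_weylDeriv_mul α hφ' hφc.deriv hk
  calc ∫ t in Ioi 0, weylDeriv α (deriv φ) t * f (S t x)
      = (∫ t in Ioi 0, weylDeriv α (deriv φ) t * (gKer (α + 1) t : ℂ)) * f (C x) +
          ∫ t in Ioi 0, weylDeriv α (deriv φ) t * rlInt 1 (fun s => f (S s y)) t := by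
        rw [← sub_eq_iff_eq_add', ← integral_mul_const,
          ← integral_sub (hint (hfS x)) ((hint hgKer).mul_const _)]
        refine setIntegral_congr_fun measurableSet_Ioi fun t ht => ?_
        simp only [apply_eq_of_mem_integralGenerator hxy (le_of_lt (mem_Ioi.1 ht)) f]
        ring
    _ = -∫ t in Ioi 0, weylDeriv α φ t * f (S t y) := by
        rw [integral_weylDeriv_deriv_mul_gKer hα hφ hφc, hφ0, neg_zero, zero_mul, zero_add,
          integral_weylDeriv_deriv_mul_rlInt_one α hφ hφc (hfS y)]

theorem integralGenerator_le_generator [IsTopologicalAddGroup E] [ContinuousSMul ℂ E]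
    [PolynormableSpace ℂ E] [T2Space E] {G : TestFn →L[ℂ] E →L[ℂ] E} (hα : 0 ≤ α)
    (hc : ∀ x : E, ContinuousOn (fun t => S t x) (Ici 0)) (hG : IsWeylIntegral α S G) :
    integralGenerator α C S ≤ generator G := by
  rintro ⟨x, y⟩ hxy φ hφ
  refine eq_of_forall_dual_eq fun f => ?_
  have hφ0 := apply_zero_of_tsupport_subset_Ici φ.continuous hφ
  have hparts := integral_weylDeriv_deriv_mul_apply hα hc hxy φ.contDiff φ.hasCompactSupport hφ0 f
  rw [← coe_lineDeriv_testFn, ← hG.apply_eq, ← hG.apply_eq] at hparts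
  rw [map_neg, _root_.neg_apply, map_neg, hparts, neg_neg]

end Generator

end WeylIntegral

end CDS

end

open CDS in
theorem theorem4p8_general {E : Type*} [AddCommGroup E] [Module ℂ E] [UniformSpace E]
    [IsUniformAddGroup E] [ContinuousSMul ℂ E] [LocallyConvexSpace ℝ E] [T2Space E]
    (hE : ∀ u : ℕ → E, CauchySeq u → ∃ x : E, Tendsto u atTop (𝓝 x))
    {C : E →L[ℂ] E} {α : ℝ} (hα : 0 ≤ α) {S : ℝ → E →L[ℂ] E}
    (hS : IsIntegratedSemigroup α C S) (hexp : IsExpEquicontinuous S) :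
    ∃ G : TestFn →L[ℂ] E →L[ℂ] E,
      IsWeylIntegral α S G ∧ IsPreCEDS C G ∧ integralGenerator α C S ≤ generator G := by
  have := polynormableSpace_of_locallyConvexSpace (E := E)
  obtain ⟨G, hG, htemp⟩ := exists_isWeylIntegral_isTemperedTwist hE α hS.continuousOn hexp
  exact ⟨G, hG, ⟨hG.isPreCDS hα hS, htemp⟩, integralGenerator_le_generator hα hS.continuousOn hG⟩

theorem theorem4p8 {E : Type*} [AddCommGroup E] [Module ℂ E] [UniformSpace E]
    [IsUniformAddGroup E] [ContinuousSMul ℂ E] [LocallyConvexSpace ℝ E] [T2Space E]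
    [BarrelledSpace ℂ E]
    (hE : ∀ u : ℕ → E, CauchySeq u → ∃ x : E, Tendsto u atTop (𝓝 x))
    (C : E →L[ℂ] E) (α : ℝ) (hα : 0 ≤ α)
    (S : ℝ → E →L[ℂ] E) (hS : CDS.IsIntegratedSemigroup α C S)
    (hexp : CDS.IsExpEquicontinuous S)
    (A : Submodule ℂ (E × E)) (hA : A = CDS.integralGenerator α C S) :
    ∃ G : CDS.TestFn →L[ℂ] (E →L[ℂ] E),
      (∀ (φ : CDS.TestFn) (x : E),
        CDS.HasIntegral (fun t => CDS.weylDeriv α φ t • S t x) (volume.restrict (Ioi 0)) (G φ x)) ∧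
      CDS.IsPreCEDS C G ∧
      A ≤ CDS.generator G := by
  subst hA
  exact theorem4p8_general hE hα hS hexp
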